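/- Let $V$ be a finite-dimensional Euclidean space (identified with its dual by the inner product), and let $k_V:V\to(0,\infty)$ satisfy $\int_V k_V\,d\omega=1$. Let $\mathcal H$ be the Hilbert space of functions $f(x)=\int_V\hat f(\omega)e^{2\pi i\langle x,\omega\rangle}d\omega$ with $\|f\|_{\mathcal H}^2=\int_V|\hat f|^2/k_V\,d\omega<\infty$. Let $X$ be a $V$-valued random variable, $Y$ a complex random variable with $\mathbb E|Y|^2<\infty$, and $\lambda>0$. For $U\in\mathrm{End}(V)$ let $f_U$ be the minimizer over $f\in\mathcal H$ of $$I(f,U,\lambda)=\tfrac12\mathbb E|Y-f(UX)|^2+\tfrac\lambda2\|f\|_{\mathcal H}^2 .$$ Fix an orthogonal decomposition $V=W\oplus W'$ and write $x=(x_W,x_{W'})$. Consider a sequence $U=U^{(k)}$ with blocks $U_{11},U_{12},U_{21},U_{22}$ such that, as $k\to\infty$, $U_{11}\to U_{11}^\infty\in\mathrm{End}(W)$; $U_{21}=0$; $U_{12}$ is arbitrary; and $|U_{22}x|\ge\Lambda_k|x|$ for all $x\in W'$, with $\Lambda_k\to+\infty$. Let $a_1,a_2,\dots$ (a finite, possibly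 empty, or infinite list of distinct points) enumerate the atoms of the law of $X_{W'}$. Put $k_W(\omega_W)=\int_{W'}k_V(\omega_W,\omega_{W'})\,d\omega_{W'}$, let $\mathcal H_W$ be the Hilbert space of functions on $W$ defined from $k_W$ as $\mathcal H$ was from $k_V$, and let $g_i^*$ be the minimizer over $g\in\mathcal H_W$ of $$\tfrac12\mathbb E\big[|Y-g(U_{11}^\infty X_W)|^2\mathbf 1_{X_{W'}=a_i}\big]+\tfrac\lambda2\|g\|_{\mathcal H_W}^2 .$$ Let $f_i$ be the function on $V$ with $\hat f_i(\omega)=\hat g_i^*(\omega_W)\,k_V(\omega)/k_W(\omega_W)$, and let $$f^{(m)}(x)=\sum_{i=1}^m f_i(x_W-U_{12}a_i,\;x_{W'}-U_{22}a_i)$$ (the sum being over all the atoms if there are fewer than $m$). Theorem. Each $f^{(m)}$ lies in $\mathcal H$. For each $m\ge 0$ the following limit exists and satisfies $$\lim_{k\to\infty}\Big(\mathbb E\big|(f^{(m)}-f_U)(UX)\big|^2+\lambda\|f^{(m)}-f_U\|_{\mathcal H}^2\Big)\le\mathbb E\big[|Y|^2\,\mathbf 1_{X_{W'}\in\{a_i\}_{i\ge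 m+1}}\big].$$ In particular $$\lim_{m\to\infty}\lim_{k\to\infty}\Big(\mathbb E\big|(f^{(m)}-f_U)(UX)\big|^2+\lambda\|f^{(m)}-f_U\|_{\mathcal H}^2\Big)=0 .$$ -/

import Mathlib

open MeasureTheory Filter Topology
open scoped FourierTransform

noncomputable section

section RKHS

variable {E : Type*} [NormedAddCommGroup E] [InnerProductSpace ℝ E] [FiniteDimensional ℝ E]
  [MeasurableSpace E] [BorelSpace E]

/-- `f` is given everywhere by the inversion formula
`f x = ∫ φ ξ * exp (2 π i ⟪x, ξ⟫) dξ` with an integrable function `φ`; the dual of `E` is identified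
with `E` through the inner product. -/
def IsFourierPair (f φ : E → ℂ) : Prop := Integrable φ ∧ f = 𝓕⁻ φ

open Classical in
/-- The Fourier transform `f̂` of a function `f` that is the inverse Fourier transform of an
integrable function (unique up to null sets, see `fourierHat_ae_eq`); `0` if there is none. -/
def fourierHat (f : E → ℂ) : E → ℂ :=
  if h : ∃ φ, IsFourierPair f φ then h.choose else 0

/-- Membership in the translation invariant reproducing kernel Hilbert space with spectral
density `κ`: `∫ |f̂|² / κ < ∞`. When `κ` is integrable and positive almost everywhere, finiteness
of this integral forces `f̂` to be integrable, by the Cauchy-Schwarz inequality. -/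
def MemRKHS (κ : E → ℝ) (f : E → ℂ) : Prop :=
  (∃ φ, IsFourierPair f φ) ∧ Integrable (fun ξ => ‖fourierHat f ξ‖ ^ 2 / κ ξ)

/-- The squared norm `∫ |f̂|² / κ` of the reproducing kernel Hilbert space. -/
def rkhsNormSq (κ : E → ℝ) (f : E → ℂ) : ℝ := ∫ ξ, ‖fourierHat f ξ‖ ^ 2 / κ ξ

theorem isFourierPair_ae_unique {f φ ψ : E → ℂ} (hφ : IsFourierPair f φ)
    (hψ : IsFourierPair f ψ) : φ =ᵐ[volume] ψ := by
  have key : ∀ (χ : E → ℂ), Integrable χ → ∀ s : SchwartzMap E ℂ,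
      ∫ x, s x • χ x = ∫ x, (𝓕 s) x • (𝓕⁻ χ) x := by
    intro χ hχ s
    have h := VectorFourier.integral_fourierIntegral_smul_eq_flip (μ := volume) (ν := volume)
      (f := 𝓕 (s : E → ℂ)) (g := χ) (L := -(innerₗ E)) Real.continuous_fourierChar
      (continuous_inner (𝕜 := ℝ) (E := E)).neg
      (by rw [← SchwartzMap.fourier_coe]; exact (𝓕 s).integrable) hχ
    have e1 : VectorFourier.fourierIntegral Real.fourierChar volume (-(innerₗ E))
        (𝓕 (s : E → ℂ)) = s := by
      have : 𝓕⁻ (𝓕 (s : E → ℂ)) = (s : E → ℂ) := by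
        rw [← SchwartzMap.fourier_coe]
        have := s.continuous.fourierInv_fourier_eq s.integrable
          (by rw [← SchwartzMap.fourier_coe]; exact (𝓕 s).integrable)
        rwa [← SchwartzMap.fourier_coe] at this
      exact this
    have e2 : VectorFourier.fourierIntegral Real.fourierChar volume (-(innerₗ E)).flip χ
        = 𝓕⁻ χ := by
      ext w
      rw [Real.fourierInv_eq]
      simp [VectorFourier.fourierIntegral, real_inner_comm]
    rw [e1, e2] at h
    simpa [SchwartzMap.fourier_coe] using h
  refine ae_eq_of_integral_contDiff_smul_eq hφ.1.locallyIntegrable hψ.1.locallyIntegrable ?_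
  intro g hg hc
  have hg₁ : HasCompactSupport (Complex.ofRealCLM ∘ g) := hc.comp_left rfl
  have hg₂ : ContDiff ℝ ((⊤ : ℕ∞) : WithTop ℕ∞) (Complex.ofRealCLM ∘ g) := by fun_prop
  have h1 := key φ hφ.1 (hg₁.toSchwartzMap hg₂)
  have h2 := key ψ hψ.1 (hg₁.toSchwartzMap hg₂)
  rw [← hφ.2] at h1
  rw [← hψ.2] at h2
  have h3 := h1.trans h2.symm
  simpa using h3

theorem isFourierPair_fourierHat {f : E → ℂ} (h : ∃ φ, IsFourierPair f φ) :
    IsFourierPair f (fourierHat f) := by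
  unfold fourierHat
  rw [dif_pos h]
  exact h.choose_spec

theorem fourierHat_ae_eq {f φ : E → ℂ} (h : IsFourierPair f φ) :
    fourierHat f =ᵐ[volume] φ :=
  isFourierPair_ae_unique (isFourierPair_fourierHat ⟨φ, h⟩) h

/-- The regularized least squares loss `½ E|Y - f(Z)|² + (lam / 2) ‖f‖²` over a (not necessarily
normalized) finite measure. -/
def ridgeLoss {Ω : Type*} [MeasurableSpace Ω] (μ : Measure Ω) (Z : Ω → E) (Y : Ω → ℂ)
    (κ : E → ℝ) (lam : ℝ) (f : E → ℂ) : ℝ :=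
  (1 / 2) * ∫ w, ‖Y w - f (Z w)‖ ^ 2 ∂μ + (lam / 2) * rkhsNormSq κ f

/-- `f` minimizes the loss over the reproducing kernel Hilbert space. -/
def IsRidgeMinimizer {Ω : Type*} [MeasurableSpace Ω] (μ : Measure Ω) (Z : Ω → E) (Y : Ω → ℂ)
    (κ : E → ℝ) (lam : ℝ) (f : E → ℂ) : Prop :=
  MemRKHS κ f ∧ ∀ h, MemRKHS κ h → ridgeLoss μ Z Y κ lam f ≤ ridgeLoss μ Z Y κ lam h

end RKHS

section Reduction

variable {V : Type*} [NormedAddCommGroup V] [InnerProductSpace ℝ V] [FiniteDimensional ℝ V]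
  [MeasurableSpace V] [BorelSpace V]

/-- The block `A ← B` of an endomorphism `U` for two subspaces `A`, `B` of `V`. -/
def block (A B : Submodule ℝ V) (U : V →L[ℝ] V) : B →L[ℝ] A :=
  A.orthogonalProjectionOnto ∘L U ∘L B.subtypeL

/-- The marginal density `k_W(ξ_W) = ∫ k_V(ξ_W, ξ_{W'}) dξ_{W'}`, with `W' = Wᗮ`. -/
def marginalDensity (W : Submodule ℝ V) (kV : V → ℝ) : W → ℝ :=
  fun ξ => ∫ η : Wᗮ, kV ((ξ : V) + (η : V))

/-- The function on `V` whose Fourier transform is `ĝ(ξ_W) k_V(ξ) / k_W(ξ_W)`. -/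
def optimalExtension (W : Submodule ℝ V) (kV : V → ℝ) (g : W → ℂ) : V → ℂ :=
  𝓕⁻ (fun ξ : V => fourierHat g (W.orthogonalProjectionOnto ξ) *
    ((kV ξ / marginalDensity W kV (W.orthogonalProjectionOnto ξ) : ℝ) : ℂ))

/-- The test function `f^{(m)}(x) = ∑ f_i(x_W - U₁₂ a_i, x_{W'} - U₂₂ a_i)` built from the first `m`
atoms `a 0, …, a (m - 1)` (or all of them, if there are only `N < m`). Here `a i ∈ W'`, so that the
argument is `x - U (a i)`. -/
def testFunction (W : Submodule ℝ V) (kV : V → ℝ) (N : ℕ∞) (a : ℕ → Wᗮ) (g : ℕ → W → ℂ)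
    (U : V →L[ℝ] V) (m : ℕ) : V → ℂ :=
  fun x => ∑ i ∈ Finset.range m,
    if (i : ℕ∞) < N then optimalExtension W kV (g i) (x - U (a i : V)) else 0

end Reduction

end

/-!
The excess loss of a function over the minimizer `f_U` is half its squared distance to `f_U` in the
norm `E|h(UX)|² + lam ‖h‖²` (`IsRidgeMinimizer.integral_sq_add_rkhsNormSq_sub`). The quantity in
the theorem is therefore twice the loss of the test function minus twice the minimal loss, and it
suffices to find the limits of both losses.

Write `A i` for the event that `X_{W'}` is the atom `a i`, and `c i` for twice the amount by which
`g i` lowers the loss of the zero function in the reduced problem on `A i` (`lossReduction`). Then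
`0 ≤ c i ≤ E[|Y|²; A i]`.

*Loss of the test function.* Translations by `U (a i)` for distinct atoms separate without bound, so
by the Riemann-Lebesgue lemma the summands of the test function become orthogonal, and at `UX` the
`i`-th summand tends to `g i (U₁₁^∞ X_W)` on `A i` and to zero elsewhere. Hence twice the loss of
`f^{(m)}` tends to `E|Y|² - ∑_{i < m} c i` (`tendsto_ridgeLoss_testFunction`).

*Minimal loss.* It is at most the loss of any test function. For a lower bound, every square
integrable `ρ` satisfies
`2 loss(f) ≥ E|Y|² - E|Y - ρ|² - lam⁻¹ ∫ k |E[ρ exp(-2πi⟨ξ, UX⟩)]|² dξ` (`le_ridgeLoss_of_dual`).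
Take `ρ = Y` off the atoms, `ρ = Y - g i (U₁₁^∞ X_W)` on `A i` for `i < M`, and `ρ = 0` on the other
atoms. The last integral is the inner product of `ρ` with its kernel average
`w ↦ E'[K(U X(w) - U X') ρ']`, where `K` is the inverse Fourier transform of `k` and `X'`, `ρ'` are
independent copies. Since `K` vanishes at infinity, only the `X'` in the same fibre of the projection
to `W'` contribute in the limit. Such a fibre is null off the atoms, and on `A i` the limit is
`lam * g i`, by the representer formula for `g i` (`IsRidgeMinimizer.lam_mul_eq`). The lower bound
thus tends to `E|Y|² - ∑_{i < M} c i - E[|Y|²; ⋃_{i ≥ M} A i]` (`exists_tendsto_le_ridgeLoss`).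

Letting `M → ∞`, twice the minimal loss tends to `E|Y|² - ∑ c i`, so the limit in the theorem is
`∑_{i ≥ m} c i`: the tail of a convergent series, bounded by `E[|Y|²; ⋃_{i ≥ m} A i]`.
-/

set_option linter.unusedSectionVars false

noncomputable section

/-! ### Inverse Fourier transforms of integrable functions -/

section Fourier

variable {E : Type*} [NormedAddCommGroup E] [InnerProductSpace ℝ E] [FiniteDimensional ℝ E]
  [MeasurableSpace E] [BorelSpace E]

theorem aestronglyMeasurable_fourierChar_smul {α : Type*} [MeasurableSpace α] {μ : Measure α}
    {m : α → ℝ} {φ : α → ℂ} (hm : Measurable m) (hφ : AEStronglyMeasurable φ μ) :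
    AEStronglyMeasurable (fun p => 𝐞 (m p) • φ p) μ :=
  (Real.continuous_fourierChar.comp_aestronglyMeasurable hm.aestronglyMeasurable).smul hφ

theorem norm_fourierInv_le_integral_norm (φ : E → ℂ) (x : E) : ‖𝓕⁻ φ x‖ ≤ ∫ ξ, ‖φ ξ‖ := by
  rw [Real.fourierInv_eq]
  refine (norm_integral_le_integral_norm _).trans_eq ?_
  simp

theorem continuous_fourierInv_of_integrable {φ : E → ℂ} (hφ : Integrable φ) :
    Continuous (𝓕⁻ φ) := by
  have h : (𝓕⁻ φ) = fun x => ∫ ξ, 𝐞 (inner ℝ ξ x) • φ ξ := by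
    ext x; rw [Real.fourierInv_eq]
  rw [h]
  refine continuous_of_dominated (bound := fun ξ => ‖φ ξ‖) ?_ ?_ hφ.norm ?_
  · intro x
    exact aestronglyMeasurable_fourierChar_smul (by fun_prop) hφ.aestronglyMeasurable
  · intro x
    simp
  · refine ae_of_all _ fun ξ => ?_
    fun_prop

theorem tendsto_fourierInv_cocompact (φ : E → ℂ) : Tendsto (𝓕⁻ φ) (cocompact E) (𝓝 0) := by
  have h1 := tendsto_integral_exp_inner_smul_cocompact φ
  have h2 : Tendsto (fun x : E => -x) (cocompact E) (cocompact E) :=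
    (Homeomorph.neg E).isClosedEmbedding.tendsto_cocompact
  refine (h1.comp h2).congr fun x => ?_
  simp [Real.fourierInv_eq]

/-- Multiplying by a character translates the inverse Fourier transform. -/
theorem fourierInv_fourierChar_smul (φ : E → ℂ) (b x : E) :
    𝓕⁻ (fun ξ => 𝐞 (-inner ℝ ξ b) • φ ξ) x = 𝓕⁻ φ (x - b) := by
  rw [Real.fourierInv_eq, Real.fourierInv_eq]
  congr 1; ext ξ
  rw [smul_smul, ← AddChar.map_add_eq_mul, inner_sub_right, sub_eq_add_neg]

theorem integrable_fourierChar_smul {φ : E → ℂ} (hφ : Integrable φ) (b : E) :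
    Integrable fun ξ => 𝐞 (-inner ℝ ξ b) • φ ξ := by
  refine hφ.congr' ?_ (ae_of_all _ fun ξ => by simp)
  exact aestronglyMeasurable_fourierChar_smul (by fun_prop) hφ.aestronglyMeasurable

end Fourier

/-! ### The Hilbert space of a spectral density -/

section RKHS

variable {E : Type*} [NormedAddCommGroup E] [InnerProductSpace ℝ E] [FiniteDimensional ℝ E]
  [MeasurableSpace E] [BorelSpace E]

/-- A spectral density: an integrable function that is nonnegative, and positive almost
everywhere. A marginal of a positive density may vanish on a null set, where the integral that
defines it diverges. -/
structure IsSpectralDensity (κ : E → ℝ) : Prop where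
  nonneg : ∀ ξ, 0 ≤ κ ξ
  ae_pos : ∀ᵐ ξ, 0 < κ ξ
  integrable : Integrable κ

variable {κ : E → ℝ} {f h : E → ℂ}

theorem MemRKHS.isFourierPair (hf : MemRKHS κ f) : IsFourierPair f (fourierHat f) :=
  isFourierPair_fourierHat hf.1

theorem MemRKHS.continuous (hf : MemRKHS κ f) : Continuous f := by
  rw [hf.isFourierPair.2]
  exact continuous_fourierInv_of_integrable hf.isFourierPair.1

theorem MemRKHS.norm_le (hf : MemRKHS κ f) (x : E) : ‖f x‖ ≤ ∫ ξ, ‖fourierHat f ξ‖ := by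
  have := norm_fourierInv_le_integral_norm (fourierHat f) x
  rwa [← hf.isFourierPair.2] at this

theorem MemRKHS.aestronglyMeasurable_fourierHat (hf : MemRKHS κ f) :
    AEStronglyMeasurable (fourierHat f) := hf.isFourierPair.1.aestronglyMeasurable

theorem IsFourierPair.memRKHS {φ : E → ℂ} (hf : IsFourierPair f φ)
    (h2 : Integrable fun ξ => ‖φ ξ‖ ^ 2 / κ ξ) : MemRKHS κ f := by
  refine ⟨⟨φ, hf⟩, h2.congr ?_⟩
  filter_upwards [fourierHat_ae_eq hf] with ξ hξ
  rw [hξ]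

theorem IsFourierPair.rkhsNormSq_eq {φ : E → ℂ} (hf : IsFourierPair f φ) (κ : E → ℝ) :
    rkhsNormSq κ f = ∫ ξ, ‖φ ξ‖ ^ 2 / κ ξ := by
  refine integral_congr_ae ?_
  filter_upwards [fourierHat_ae_eq hf] with ξ hξ
  rw [hξ]

theorem IsFourierPair.add_smul {φ ψ : E → ℂ} (hf : IsFourierPair f φ) (hh : IsFourierPair h ψ)
    (t : ℝ) : IsFourierPair (f + t • h) (φ + t • ψ) := by
  refine ⟨hf.1.add (hh.1.smul t), ?_⟩
  ext x
  have h1 := integrable_fourierChar_smul hf.1 (-x)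
  have h2 := integrable_fourierChar_smul hh.1 (-x)
  simp only [inner_neg_right, neg_neg] at h1 h2
  have h3 := integral_add h1 (h2.smul t)
  simp only [Pi.smul_apply, integral_smul] at h3
  rw [hf.2, hh.2, Pi.add_apply, Pi.smul_apply, Real.fourierInv_eq, Real.fourierInv_eq,
    Real.fourierInv_eq, ← h3]
  congr 1; ext ξ
  simp only [Pi.add_apply, Pi.smul_apply, smul_add]
  rw [smul_comm]

/-- The real part of the inner product `∫ f̂ conj(ĥ) / κ`. -/
def rkhsInner (κ : E → ℝ) (f h : E → ℂ) : ℝ :=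
  ∫ ξ, inner ℝ (fourierHat f ξ) (fourierHat h ξ) / κ ξ

theorem abs_real_inner_le_sq_add_sq (a b : ℂ) : |inner ℝ a b| ≤ ‖a‖ ^ 2 + ‖b‖ ^ 2 := by
  have := abs_real_inner_le_norm a b
  nlinarith [sq_nonneg (‖a‖ - ‖b‖), sq_nonneg ‖a‖, sq_nonneg ‖b‖]

theorem integrable_inner_div (hκ : IsSpectralDensity κ) {φ ψ : E → ℂ}
    (hφ : AEStronglyMeasurable φ) (hψ : AEStronglyMeasurable ψ)
    (hφ2 : Integrable fun ξ => ‖φ ξ‖ ^ 2 / κ ξ) (hψ2 : Integrable fun ξ => ‖ψ ξ‖ ^ 2 / κ ξ) :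
    Integrable fun ξ => inner ℝ (φ ξ) (ψ ξ) / κ ξ := by
  refine (hφ2.add hψ2).mono' ?_ ?_
  · exact (hφ.inner hψ).div₀ hκ.integrable.aestronglyMeasurable
  · refine ae_of_all _ fun ξ => ?_
    rw [Pi.add_apply, ← add_div, norm_div, Real.norm_eq_abs, Real.norm_eq_abs,
      abs_of_nonneg (hκ.nonneg ξ)]
    gcongr
    · exact hκ.nonneg ξ
    · exact abs_real_inner_le_sq_add_sq _ _

theorem norm_add_smul_sq (a b : ℂ) (t : ℝ) :
    ‖a + t • b‖ ^ 2 = ‖a‖ ^ 2 + 2 * t * inner ℝ a b + t ^ 2 * ‖b‖ ^ 2 := by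
  rw [norm_add_sq_real, inner_smul_right, norm_smul, mul_pow, Real.norm_eq_abs, sq_abs]
  ring

theorem MemRKHS.add_smul (hκ : IsSpectralDensity κ) (hf : MemRKHS κ f) (hh : MemRKHS κ h)
    (t : ℝ) : MemRKHS κ (f + t • h) ∧
      rkhsNormSq κ (f + t • h)
        = rkhsNormSq κ f + 2 * t * rkhsInner κ f h + t ^ 2 * rkhsNormSq κ h := by
  have hp := hf.isFourierPair.add_smul hh.isFourierPair t
  have hI := integrable_inner_div hκ hf.aestronglyMeasurable_fourierHat
    hh.aestronglyMeasurable_fourierHat hf.2 hh.2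
  have e : (fun ξ => ‖(fourierHat f + t • fourierHat h) ξ‖ ^ 2 / κ ξ) = fun ξ =>
      ‖fourierHat f ξ‖ ^ 2 / κ ξ + (2 * t) * (inner ℝ (fourierHat f ξ) (fourierHat h ξ) / κ ξ)
        + t ^ 2 * (‖fourierHat h ξ‖ ^ 2 / κ ξ) := by
    ext ξ
    rw [Pi.add_apply, Pi.smul_apply, norm_add_smul_sq]
    ring
  have i1 := hf.2.add (hI.const_mul (2 * t))
  have i2 := hh.2.const_mul (t ^ 2)
  refine ⟨hp.memRKHS ?_, ?_⟩
  · rw [e]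
    exact i1.add i2
  · rw [hp.rkhsNormSq_eq, e]
    have := integral_add i1 i2
    simp only [Pi.add_apply] at this
    rw [this, integral_add hf.2 (hI.const_mul (2 * t)), integral_const_mul, integral_const_mul]
    rfl

theorem MemRKHS.sub (hκ : IsSpectralDensity κ) (hf : MemRKHS κ f) (hh : MemRKHS κ h) :
    MemRKHS κ (f - h) := by
  have := (hf.add_smul hκ hh (-1)).1
  rwa [neg_one_smul, ← sub_eq_add_neg] at this

theorem rkhsNormSq_nonneg (hκ : IsSpectralDensity κ) (f : E → ℂ) : 0 ≤ rkhsNormSq κ f :=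
  integral_nonneg fun ξ => div_nonneg (sq_nonneg _) (hκ.nonneg ξ)

end RKHS

/-! ### Regularized least squares: optimality conditions and duality -/

section Ridge

variable {E : Type*} [NormedAddCommGroup E] [InnerProductSpace ℝ E] [FiniteDimensional ℝ E]
  [MeasurableSpace E] [BorelSpace E] {κ : E → ℝ} {f h : E → ℂ}
  {Ω : Type*} [MeasurableSpace Ω] {μ : Measure Ω} [IsFiniteMeasure μ] {Z : Ω → E} {Y : Ω → ℂ}
  {lam : ℝ}

theorem MemRKHS.memLp_comp (hf : MemRKHS κ f) (hZ : Measurable Z) :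
    MemLp (fun w => f (Z w)) 2 μ :=
  MemLp.of_bound (hf.continuous.measurable.comp hZ).aestronglyMeasurable _
    (ae_of_all _ fun w => hf.norm_le (Z w))

theorem MeasureTheory.MemLp.integrable_norm_sq {u : Ω → ℂ} (hu : MemLp u 2 μ) :
    Integrable (fun w => ‖u w‖ ^ 2) μ := hu.integrable_norm_pow (by norm_num)

theorem MeasureTheory.MemLp.integrable_real_inner {u v : Ω → ℂ} (hu : MemLp u 2 μ)
    (hv : MemLp v 2 μ) : Integrable (fun w => inner ℝ (u w) (v w)) μ :=
  (hu.integrable_norm_sq.add hv.integrable_norm_sq).mono' (hu.1.inner hv.1)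
    (ae_of_all _ fun _ => abs_real_inner_le_sq_add_sq _ _)

theorem integral_norm_add_smul_sq {u v : Ω → ℂ} (hu : MemLp u 2 μ) (hv : MemLp v 2 μ) (t : ℝ) :
    ∫ w, ‖u w + t • v w‖ ^ 2 ∂μ
      = ∫ w, ‖u w‖ ^ 2 ∂μ + 2 * t * ∫ w, inner ℝ (u w) (v w) ∂μ + t ^ 2 * ∫ w, ‖v w‖ ^ 2 ∂μ := by
  have i1 := (hu.integrable_real_inner hv).const_mul (2 * t)
  have i2 := hv.integrable_norm_sq.const_mul (t ^ 2)
  simp_rw [norm_add_smul_sq]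
  have := integral_add (hu.integrable_norm_sq.add i1) i2
  simp only [Pi.add_apply] at this
  rw [this, integral_add hu.integrable_norm_sq i1, integral_const_mul, integral_const_mul]

/-- The loss is quadratic along lines. -/
theorem ridgeLoss_add_smul (hκ : IsSpectralDensity κ) (hf : MemRKHS κ f) (hh : MemRKHS κ h)
    (hZ : Measurable Z) (hY : MemLp Y 2 μ) (t : ℝ) :
    ridgeLoss μ Z Y κ lam (f + t • h) = ridgeLoss μ Z Y κ lam f
      + t * (lam * rkhsInner κ f h - ∫ w, inner ℝ (Y w - f (Z w)) (h (Z w)) ∂μ)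
      + t ^ 2 / 2 * (∫ w, ‖h (Z w)‖ ^ 2 ∂μ + lam * rkhsNormSq κ h) := by
  have e : (fun w => ‖Y w - (f + t • h) (Z w)‖ ^ 2)
      = fun w => ‖(Y w - f (Z w)) + (-t) • h (Z w)‖ ^ 2 := by
    ext w
    congr 2
    simp only [Pi.add_apply, Pi.smul_apply, neg_smul]
    ring
  have e2 := integral_norm_add_smul_sq (hY.sub (hf.memLp_comp hZ)) (hh.memLp_comp hZ) (-t)
  simp only [Pi.sub_apply] at e2
  unfold ridgeLoss
  rw [(hf.add_smul hκ hh t).2, e, e2]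
  ring

theorem eq_zero_of_forall_mul_add_sq_nonneg {B Q : ℝ} (hQ : 0 ≤ Q)
    (h : ∀ t : ℝ, 0 ≤ t * B + t ^ 2 / 2 * Q) : B = 0 := by
  have h1 := h (-B / (Q + 1))
  have h2 : -B / (Q + 1) * B + (-B / (Q + 1)) ^ 2 / 2 * Q
      = -(B ^ 2 * ((Q + 2) / (2 * (Q + 1) ^ 2))) := by
    field_simp; ring
  rw [h2] at h1
  have h3 : 0 < (Q + 2) / (2 * (Q + 1) ^ 2) := by positivity
  have h4 : B ^ 2 ≤ 0 := by nlinarith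
  exact pow_eq_zero_iff two_ne_zero |>.1 (le_antisymm h4 (sq_nonneg B))

/-- The normal equations of a minimizer. -/
theorem IsRidgeMinimizer.rkhsInner_eq (hκ : IsSpectralDensity κ) (hlam : 0 < lam)
    (hZ : Measurable Z) (hY : MemLp Y 2 μ) (hf : IsRidgeMinimizer μ Z Y κ lam f)
    (hh : MemRKHS κ h) :
    lam * rkhsInner κ f h = ∫ w, inner ℝ (Y w - f (Z w)) (h (Z w)) ∂μ := by
  refine sub_eq_zero.1 (eq_zero_of_forall_mul_add_sq_nonneg
    (Q := ∫ w, ‖h (Z w)‖ ^ 2 ∂μ + lam * rkhsNormSq κ h) ?_ fun t => ?_)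
  · have := rkhsNormSq_nonneg hκ h
    positivity
  · have h1 := hf.2 _ (hf.1.add_smul hκ hh t).1
    rw [ridgeLoss_add_smul hκ hf.1 hh hZ hY] at h1
    linarith

/-- The excess loss of `h` over the minimizer `f` is half the squared distance of `h` and `f` in
the norm of the quadratic part of the loss. -/
theorem IsRidgeMinimizer.integral_sq_add_rkhsNormSq_sub (hκ : IsSpectralDensity κ)
    (hlam : 0 < lam) (hZ : Measurable Z) (hY : MemLp Y 2 μ)
    (hf : IsRidgeMinimizer μ Z Y κ lam f) (hh : MemRKHS κ h) :
    (∫ w, ‖(h - f) (Z w)‖ ^ 2 ∂μ) + lam * rkhsNormSq κ (h - f)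
      = 2 * ridgeLoss μ Z Y κ lam h - 2 * ridgeLoss μ Z Y κ lam f := by
  have hd := hh.sub hκ hf.1
  have h1 := ridgeLoss_add_smul (lam := lam) hκ hf.1 hd hZ hY 1
  rw [hf.rkhsInner_eq hκ hlam hZ hY hd, one_smul, add_sub_cancel] at h1
  linarith

theorem rkhsInner_self (κ : E → ℝ) (f : E → ℂ) : rkhsInner κ f f = rkhsNormSq κ f := by
  simp [rkhsInner, rkhsNormSq]

/-- The Fourier transform of the pushforward under `Z` of the complex measure `ρ μ`. -/
def featureMean (μ : Measure Ω) (Z : Ω → E) (ρ : Ω → ℂ) (ξ : E) : ℂ :=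
  ∫ w, 𝐞 (-inner ℝ ξ (Z w)) • ρ w ∂μ

theorem norm_featureMean_le (ρ : Ω → ℂ) (ξ : E) :
    ‖featureMean μ Z ρ ξ‖ ≤ ∫ w, ‖ρ w‖ ∂μ := by
  refine (norm_integral_le_integral_norm _).trans_eq ?_
  simp

theorem continuous_featureMean (hZ : Measurable Z) {ρ : Ω → ℂ} (hρ : Integrable ρ μ) :
    Continuous (featureMean μ Z ρ) := by
  refine continuous_of_dominated (bound := fun w => ‖ρ w‖) ?_ ?_ hρ.norm ?_
  · intro ξ
    exact aestronglyMeasurable_fourierChar_smul (by fun_prop) hρ.aestronglyMeasurable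
  · intro ξ
    simp
  · refine ae_of_all _ fun w => ?_
    fun_prop

theorem real_inner_circle_smul_right (c : ℝ) (a b : ℂ) :
    inner ℝ a (𝐞 c • b) = inner ℝ (𝐞 (-c) • a) b := by
  rw [Complex.inner, Complex.inner, Circle.smul_def, Circle.smul_def, AddChar.map_neg_eq_inv,
    Circle.coe_inv_eq_conj]
  simp only [smul_eq_mul, map_mul, Complex.conj_conj]
  congr 1; ring

/-- The adjoint of `φ ↦ (𝓕⁻ φ) ∘ Z` is `featureMean`. -/
theorem integral_inner_fourierInv (hZ : Measurable Z) {ρ : Ω → ℂ} (hρ : Integrable ρ μ)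
    {φ : E → ℂ} (hφ : Integrable φ) :
    ∫ w, inner ℝ (ρ w) (𝓕⁻ φ (Z w)) ∂μ = ∫ ξ, inner ℝ (featureMean μ Z ρ ξ) (φ ξ) := by
  have hc : Measurable fun p : Ω × E => (inner ℝ p.2 (Z p.1) : ℝ) :=
    Measurable.inner measurable_snd (hZ.comp measurable_fst)
  have hint : Integrable (fun p : Ω × E => inner ℝ (ρ p.1) (𝐞 (inner ℝ p.2 (Z p.1)) • φ p.2))
      (μ.prod volume) := by
    refine (hρ.norm.mul_prod hφ.norm).mono' ?_ (ae_of_all _ fun p => ?_)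
    · exact hρ.aestronglyMeasurable.comp_fst.inner
        (aestronglyMeasurable_fourierChar_smul hc hφ.aestronglyMeasurable.comp_snd)
    · refine (abs_real_inner_le_norm _ _).trans_eq ?_
      simp
  calc ∫ w, inner ℝ (ρ w) (𝓕⁻ φ (Z w)) ∂μ
      = ∫ w, (∫ ξ, inner ℝ (ρ w) (𝐞 (inner ℝ ξ (Z w)) • φ ξ)) ∂μ := by
        congr 1; ext w
        have h1 := integrable_fourierChar_smul hφ (-(Z w))
        simp only [inner_neg_right, neg_neg] at h1
        rw [Real.fourierInv_eq, integral_inner h1]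
    _ = ∫ ξ, (∫ w, inner ℝ (ρ w) (𝐞 (inner ℝ ξ (Z w)) • φ ξ) ∂μ) := integral_integral_swap hint
    _ = ∫ ξ, inner ℝ (featureMean μ Z ρ ξ) (φ ξ) := by
        congr 1; ext ξ
        have h1 : Integrable (fun w => 𝐞 (-inner ℝ ξ (Z w)) • ρ w) μ := by
          refine hρ.congr' ?_ (ae_of_all _ fun w => by simp)
          exact aestronglyMeasurable_fourierChar_smul (by fun_prop) hρ.aestronglyMeasurable
        rw [featureMean, real_inner_comm, ← integral_inner h1]
        congr 1; ext w
        rw [real_inner_circle_smul_right, real_inner_comm]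

theorem IsSpectralDensity.integrable_mul_featureMean (hκ : IsSpectralDensity κ)
    (hZ : Measurable Z) {ρ : Ω → ℂ} (hρ : Integrable ρ μ) :
    Integrable fun ξ => (κ ξ : ℂ) * featureMean μ Z ρ ξ :=
  hκ.integrable.ofReal.mul_bdd (continuous_featureMean hZ hρ).aestronglyMeasurable
    (ae_of_all _ (norm_featureMean_le ρ))

theorem IsSpectralDensity.integrable_mul_featureMean_sq (hκ : IsSpectralDensity κ)
    (hZ : Measurable Z) {ρ : Ω → ℂ} (hρ : Integrable ρ μ) :
    Integrable fun ξ => κ ξ * ‖featureMean μ Z ρ ξ‖ ^ 2 := by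
  refine hκ.integrable.mul_bdd (c := (∫ w, ‖ρ w‖ ∂μ) ^ 2)
    ((continuous_featureMean hZ hρ).norm.pow 2).aestronglyMeasurable (ae_of_all _ fun ξ => ?_)
  rw [norm_pow, norm_norm]
  gcongr
  exact norm_featureMean_le ρ ξ

/-- The function with Fourier transform `κ · featureMean` is the kernel average of `ρ`. -/
theorem fourierInv_mul_featureMean (hκ : IsSpectralDensity κ)
    (hZ : Measurable Z) {ρ : Ω → ℂ} (hρ : Integrable ρ μ) (z : E) :
    𝓕⁻ (fun ξ => (κ ξ : ℂ) * featureMean μ Z ρ ξ) z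
      = ∫ w, 𝓕⁻ (fun ξ => (κ ξ : ℂ)) (z - Z w) * ρ w ∂μ := by
  have hc : Measurable fun p : E × Ω => (inner ℝ p.1 (z - Z p.2) : ℝ) :=
    Measurable.inner measurable_fst (measurable_const.sub (hZ.comp measurable_snd))
  have hint : Integrable (fun p : E × Ω => 𝐞 (inner ℝ p.1 (z - Z p.2)) • ((κ p.1 : ℂ) * ρ p.2))
      (volume.prod μ) := by
    refine (hκ.integrable.ofReal.mul_prod hρ).congr' ?_
      (ae_of_all _ fun p => by simp)
    exact aestronglyMeasurable_fourierChar_smul hc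
      (hκ.integrable.ofReal.mul_prod hρ).aestronglyMeasurable
  rw [Real.fourierInv_eq]
  calc ∫ ξ, 𝐞 (inner ℝ ξ z) • ((κ ξ : ℂ) * featureMean μ Z ρ ξ)
      = ∫ ξ, ∫ w, 𝐞 (inner ℝ ξ (z - Z w)) • ((κ ξ : ℂ) * ρ w) ∂μ := by
        congr 1; ext ξ
        rw [featureMean, ← integral_const_mul, Circle.smul_def, ← integral_smul]
        congr 1; ext w
        rw [inner_sub_right, sub_eq_add_neg, AddChar.map_add_eq_mul]
        simp only [Circle.smul_def, smul_eq_mul, Circle.coe_mul]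
        ring
    _ = ∫ w, (∫ ξ, 𝐞 (inner ℝ ξ (z - Z w)) • ((κ ξ : ℂ) * ρ w)) ∂μ := integral_integral_swap hint
    _ = _ := by
        congr 1; ext w
        rw [Real.fourierInv_eq, ← integral_mul_const]
        congr 1; ext ξ
        simp only [Circle.smul_def, smul_eq_mul, mul_assoc]

/-- The dual expression of the squared norm of a kernel average. -/
theorem integral_mul_featureMean_sq (hκ : IsSpectralDensity κ)
    (hZ : Measurable Z) {ρ : Ω → ℂ} (hρ : Integrable ρ μ) :
    ∫ ξ, κ ξ * ‖featureMean μ Z ρ ξ‖ ^ 2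
      = ∫ w, inner ℝ (ρ w) (∫ w', 𝓕⁻ (fun ξ => (κ ξ : ℂ)) (Z w - Z w') * ρ w' ∂μ) ∂μ := by
  simp_rw [← fourierInv_mul_featureMean hκ hZ hρ]
  rw [integral_inner_fourierInv hZ hρ (hκ.integrable_mul_featureMean hZ hρ)]
  congr 1; ext ξ
  rw [← real_inner_self_eq_norm_sq, ← Complex.real_smul, inner_smul_right]

/-- The representer formula: a minimizer is `1 / lam` times the kernel average of its residual. -/
theorem IsRidgeMinimizer.lam_mul_eq (hκ : IsSpectralDensity κ) (hlam : 0 < lam)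
    (hZ : Measurable Z) (hY : MemLp Y 2 μ) (hf : IsRidgeMinimizer μ Z Y κ lam f) (z : E) :
    (lam : ℂ) * f z = ∫ w, 𝓕⁻ (fun ξ => (κ ξ : ℂ)) (z - Z w) * (Y w - f (Z w)) ∂μ := by
  set ρ : Ω → ℂ := fun w => Y w - f (Z w) with hρdef
  have hρ : Integrable ρ μ := (hY.sub (hf.1.memLp_comp hZ)).integrable (by norm_num)
  set Φ := featureMean μ Z ρ with hΦ
  have hΦm : AEStronglyMeasurable Φ := (continuous_featureMean hZ hρ).aestronglyMeasurable
  -- the defect of the representer formula in Fourier space is tested against itself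
  set χ : E → ℂ := fun ξ => (κ ξ : ℂ) * Φ ξ with hχ
  have hχi : Integrable χ := hκ.integrable_mul_featureMean hZ hρ
  have hχp : IsFourierPair (𝓕⁻ χ) χ := ⟨hχi, rfl⟩
  have hχmem : MemRKHS κ (𝓕⁻ χ) := by
    refine hχp.memRKHS ((hκ.integrable_mul_featureMean_sq hZ hρ).congr ?_)
    filter_upwards [hκ.ae_pos] with ξ hξ
    rw [hχ, norm_mul, Complex.norm_real, Real.norm_eq_abs, mul_pow, sq_abs, hΦ]
    field_simp
  have hup := hχp.add_smul hf.1.isFourierPair (-lam)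
  have humem := (hχmem.add_smul hκ hf.1 (-lam)).1
  set u := 𝓕⁻ χ + (-lam) • f with hu
  set ψ := χ + (-lam) • fourierHat f with hψ
  have h1 := hf.rkhsInner_eq hκ hlam hZ hY humem
  have h2 : ∫ w, inner ℝ (Y w - f (Z w)) (u (Z w)) ∂μ = ∫ ξ, inner ℝ (Φ ξ) (ψ ξ) := by
    rw [hup.2]; exact integral_inner_fourierInv hZ hρ hup.1
  have hψ2 : Integrable fun ξ => ‖ψ ξ‖ ^ 2 / κ ξ := by
    refine humem.2.congr ?_
    filter_upwards [fourierHat_ae_eq hup] with ξ hξ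
    rw [hξ]
  have i1 : Integrable fun ξ => inner ℝ (fourierHat f ξ) (ψ ξ) / κ ξ :=
    integrable_inner_div hκ hf.1.aestronglyMeasurable_fourierHat hup.1.1 hf.1.2 hψ2
  have i2 : Integrable fun ξ => inner ℝ (Φ ξ) (ψ ξ) := by
    refine (hup.1.norm.const_mul (∫ w, ‖ρ w‖ ∂μ)).mono' (hΦm.inner hup.1.1)
      (ae_of_all _ fun ξ => ?_)
    refine (abs_real_inner_le_norm _ _).trans ?_
    gcongr
    exact norm_featureMean_le ρ ξ
  have h3 : rkhsInner κ f u = ∫ ξ, inner ℝ (fourierHat f ξ) (ψ ξ) / κ ξ := by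
    refine integral_congr_ae ?_
    filter_upwards [fourierHat_ae_eq hup] with ξ hξ
    rw [hξ]
  have h4 : ∫ ξ, ‖ψ ξ‖ ^ 2 / κ ξ = 0 := by
    have h5 : ∫ ξ, (inner ℝ (Φ ξ) (ψ ξ) - lam * (inner ℝ (fourierHat f ξ) (ψ ξ) / κ ξ)) = 0 := by
      rw [integral_sub i2 (i1.const_mul lam), integral_const_mul, ← h3, h1, h2, sub_self]
    rw [← h5]
    refine integral_congr_ae ?_
    filter_upwards [hκ.ae_pos] with ξ hξ
    have h6 : inner ℝ (ψ ξ) (ψ ξ)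
        = κ ξ * inner ℝ (Φ ξ) (ψ ξ) - lam * inner ℝ (fourierHat f ξ) (ψ ξ) := by
      have : ψ ξ = κ ξ • Φ ξ + (-lam) • fourierHat f ξ := by
        simp [hψ, hχ]
      have h7 : inner ℝ (ψ ξ) (ψ ξ) = inner ℝ (κ ξ • Φ ξ + (-lam) • fourierHat f ξ) (ψ ξ) := by
        rw [← this]
      rw [h7, inner_add_left, real_inner_smul_left, real_inner_smul_left]
      ring
    rw [← real_inner_self_eq_norm_sq, h6]
    field_simp
  rw [integral_eq_zero_iff_of_nonneg (fun ξ => div_nonneg (sq_nonneg _) (hκ.nonneg ξ)) hψ2] at h4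
  have h7 : ψ =ᵐ[volume] 0 := by
    filter_upwards [h4, hκ.ae_pos] with ξ h8 hξ
    have : ‖ψ ξ‖ ^ 2 = 0 := by
      simpa [hξ.ne'] using h8
    simpa using this
  have h8 : u z = 0 := by
    rw [hup.2, Real.fourierInv_eq, ← integral_zero E ℂ (μ := volume)]
    refine integral_congr_ae ?_
    filter_upwards [h7] with ξ hξ
    rw [hξ]; simp
  rw [← fourierInv_mul_featureMean hκ hZ hρ]
  have h9 : 𝓕⁻ χ z - lam * f z = 0 := by
    rw [← h8, hu]; simp [sub_eq_add_neg]
  exact (sub_eq_zero.1 h9).symm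

/-- Weak duality: every `ρ` gives a lower bound for the loss. -/
theorem le_ridgeLoss_of_dual (hκ : IsSpectralDensity κ) (hlam : 0 < lam) (hZ : Measurable Z)
    (hY : MemLp Y 2 μ) (hf : MemRKHS κ f) {ρ : Ω → ℂ} (hρ : MemLp ρ 2 μ) :
    ∫ w, ‖Y w‖ ^ 2 ∂μ - ∫ w, ‖Y w - ρ w‖ ^ 2 ∂μ
        - 1 / lam * ∫ ξ, κ ξ * ‖featureMean μ Z ρ ξ‖ ^ 2
      ≤ 2 * ridgeLoss μ Z Y κ lam f := by
  have hρ1 : Integrable ρ μ := hρ.integrable (by norm_num)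
  have hfZ : MemLp (fun w => f (Z w)) 2 μ := hf.memLp_comp hZ
  have e1 : ∫ w, inner ℝ (ρ w) (f (Z w)) ∂μ
      = ∫ ξ, inner ℝ (featureMean μ Z ρ ξ) (fourierHat f ξ) := by
    conv_lhs => rw [hf.isFourierPair.2]
    exact integral_inner_fourierInv hZ hρ1 hf.isFourierPair.1
  have i2 : Integrable fun ξ => inner ℝ (featureMean μ Z ρ ξ) (fourierHat f ξ) := by
    refine (hf.isFourierPair.1.norm.const_mul (∫ w, ‖ρ w‖ ∂μ)).mono'
      ((continuous_featureMean hZ hρ1).aestronglyMeasurable.inner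
        hf.aestronglyMeasurable_fourierHat) (ae_of_all _ fun ξ => ?_)
    refine (abs_real_inner_le_norm _ _).trans ?_
    gcongr
    exact norm_featureMean_le ρ ξ
  have h1 : ∫ w, ‖Y w‖ ^ 2 ∂μ - ∫ w, ‖Y w - ρ w‖ ^ 2 ∂μ - 2 * ∫ w, inner ℝ (ρ w) (f (Z w)) ∂μ
      ≤ ∫ w, ‖Y w - f (Z w)‖ ^ 2 ∂μ := by
    have j1 := hY.integrable_norm_sq
    have j2 := (hY.sub hρ).integrable_norm_sq
    have j3 := (hρ.integrable_real_inner hfZ).const_mul 2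
    have j4 := (hY.sub hfZ).integrable_norm_sq
    simp only [Pi.sub_apply] at j2 j4
    have j5 := integral_sub (j1.sub j2) j3
    simp only [Pi.sub_apply] at j5
    rw [← integral_sub j1 j2, ← integral_const_mul, ← j5]
    refine integral_mono ((j1.sub j2).sub j3) j4 fun w => ?_
    have h2 := norm_sub_sq_real (Y w - f (Z w)) (ρ w)
    have h3 := norm_sub_sq_real (Y w) (ρ w)
    have h4 := sq_nonneg ‖Y w - f (Z w) - ρ w‖
    rw [inner_sub_left, real_inner_comm (ρ w) (f (Z w))] at h2
    simp only at *
    linarith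
  have h2 : 2 * (∫ ξ, inner ℝ (featureMean μ Z ρ ξ) (fourierHat f ξ))
      - 1 / lam * ∫ ξ, κ ξ * ‖featureMean μ Z ρ ξ‖ ^ 2 ≤ lam * rkhsNormSq κ f := by
    have i3 := hκ.integrable_mul_featureMean_sq hZ hρ1
    rw [rkhsNormSq, ← integral_const_mul, ← integral_const_mul, ← integral_const_mul,
      ← integral_sub (i2.const_mul 2) (i3.const_mul (1 / lam))]
    refine integral_mono_ae ((i2.const_mul 2).sub (i3.const_mul (1 / lam)))
      (hf.2.const_mul lam) ?_
    filter_upwards [hκ.ae_pos] with ξ hξ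
    set p := featureMean μ Z ρ ξ
    set q := fourierHat f ξ
    have h3 := real_inner_le_norm p q
    have h4 : lam * (‖q‖ ^ 2 / κ ξ) - (2 * (‖p‖ * ‖q‖) - 1 / lam * (κ ξ * ‖p‖ ^ 2))
        = (lam * ‖q‖ - κ ξ * ‖p‖) ^ 2 / (lam * κ ξ) := by
      field_simp; ring
    have h5 : 0 ≤ (lam * ‖q‖ - κ ξ * ‖p‖) ^ 2 / (lam * κ ξ) := by positivity
    linarith
  unfold ridgeLoss
  rw [e1] at h1
  linarith

end Ridge

/-! ### Integration along an orthogonal decomposition -/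

section Decomposition

variable {V : Type*} [NormedAddCommGroup V] [InnerProductSpace ℝ V] [FiniteDimensional ℝ V]
  [MeasurableSpace V] [BorelSpace V] {W : Submodule ℝ V} {kV : V → ℝ}

/-- The addition map `W × Wᗮ → V` as a measurable equivalence. -/
def sumMeasurableEquiv (W : Submodule ℝ V) : (W × Wᗮ) ≃ᵐ V :=
  (MeasurableEquiv.toLp 2 _).trans W.orthogonalDecomposition.symm.toHomeomorph.toMeasurableEquiv

theorem sumMeasurableEquiv_apply (p : W × Wᗮ) :
    sumMeasurableEquiv W p = (p.1 : V) + (p.2 : V) := by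
  simp [sumMeasurableEquiv]

theorem measurePreserving_sumMeasurableEquiv (W : Submodule ℝ V) :
    MeasurePreserving (sumMeasurableEquiv W) (volume.prod volume) volume :=
  (W.orthogonalDecomposition.symm.measurePreserving).comp (WithLp.volume_preserving_toLp W Wᗮ)

theorem orthogonalProjectionOnto_add_coe (p : W × Wᗮ) :
    W.orthogonalProjectionOnto ((p.1 : V) + (p.2 : V)) = p.1 := by
  simp

theorem isSpectralDensity_of_pos (hkpos : ∀ ξ, 0 < kV ξ) (hkint : Integrable kV) :
    IsSpectralDensity kV :=
  ⟨fun ξ => (hkpos ξ).le, ae_of_all _ hkpos, hkint⟩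

theorem integrable_comp_sum {F : Type*} [NormedAddCommGroup F] {u : V → F} (hu : Integrable u) :
    Integrable (fun p : W × Wᗮ => u ((p.1 : V) + (p.2 : V))) (volume.prod volume) := by
  have := (measurePreserving_sumMeasurableEquiv W).integrable_comp_of_integrable hu
  simpa only [Function.comp_def, sumMeasurableEquiv_apply] using this

theorem isSpectralDensity_marginalDensity (W : Submodule ℝ V) (hkpos : ∀ ξ, 0 < kV ξ)
    (hkint : Integrable kV) : IsSpectralDensity (marginalDensity W kV) where
  nonneg ξ := integral_nonneg fun η => (hkpos _).le
  ae_pos := by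
    filter_upwards [(integrable_comp_sum (W := W) hkint).prod_right_ae] with ξ hξ
    have h1 : (Function.support fun η : Wᗮ => kV ((ξ : V) + (η : V))) = Set.univ :=
      Set.eq_univ_of_forall fun η => (hkpos _).ne'
    refine (integral_pos_iff_support_of_nonneg (fun η => (hkpos _).le) hξ).2 ?_
    rw [h1]
    exact Measure.measure_univ_pos.2 (NeZero.ne _)
  integrable := (integrable_comp_sum (W := W) hkint).integral_prod_left

/-- The marginal of the measure with density `kV` has density `marginalDensity W kV`. -/
theorem integral_smul_comp_orthogonalProjectionOnto {F : Type*} [NormedAddCommGroup F]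
    [NormedSpace ℝ F] [CompleteSpace F] (hkpos : ∀ ξ, 0 < kV ξ) (hkint : Integrable kV)
    {G : W → F} (hG : AEStronglyMeasurable G)
    (hGi : Integrable fun ξ => marginalDensity W kV ξ • G ξ) :
    Integrable (fun ω : V => kV ω • G (W.orthogonalProjectionOnto ω)) ∧
      ∫ ω : V, kV ω • G (W.orthogonalProjectionOnto ω) = ∫ ξ, marginalDensity W kV ξ • G ξ := by
  have hmp := measurePreserving_sumMeasurableEquiv W
  have hkp := integrable_comp_sum (W := W) hkint
  have e : (fun ω : V => kV ω • G (W.orthogonalProjectionOnto ω)) ∘ sumMeasurableEquiv W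
      = fun p : W × Wᗮ => kV ((p.1 : V) + (p.2 : V)) • G p.1 := by
    ext p
    rw [Function.comp_apply, sumMeasurableEquiv_apply, orthogonalProjectionOnto_add_coe]
  have hint : Integrable (fun p : W × Wᗮ => kV ((p.1 : V) + (p.2 : V)) • G p.1)
      (volume.prod volume) := by
    refine (integrable_prod_iff (hkp.aestronglyMeasurable.smul hG.comp_fst)).2 ⟨?_, ?_⟩
    · filter_upwards [hkp.prod_right_ae] with ξ hξ
      exact hξ.smul_const (G ξ)
    · refine hGi.norm.congr (ae_of_all _ fun ξ => ?_)
      simp only [Pi.smul_apply', norm_smul, Real.norm_eq_abs, abs_of_pos (hkpos _)]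
      rw [integral_mul_const, abs_of_nonneg]
      · rfl
      · exact integral_nonneg fun η => (hkpos _).le
  refine ⟨?_, ?_⟩
  · rw [← hmp.integrable_comp_emb (sumMeasurableEquiv W).measurableEmbedding, e]
    exact hint
  · rw [← hmp.integral_comp (sumMeasurableEquiv W).measurableEmbedding]
    have e' := fun p => congrFun e p
    simp only [Function.comp_apply] at e'
    simp_rw [e']
    rw [integral_prod _ hint]
    congr 1; ext ξ
    exact integral_smul_const (fun η : Wᗮ => kV ((ξ : V) + (η : V))) (G ξ)

theorem inner_coe_eq_inner_orthogonalProjectionOnto (ω : V) (x : W) :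
    inner ℝ ω (x : V) = inner ℝ (W.orthogonalProjectionOnto ω) x := by
  rw [← Submodule.inner_orthogonalProjectionOnto_eq_of_mem_right x ω,
    real_inner_comm, Submodule.coe_inner, real_inner_comm]

/-- The reproducing kernel of the marginal density is the restriction to `W` of the kernel. -/
theorem fourierInv_coe_eq_fourierInv_marginalDensity (hkpos : ∀ ξ, 0 < kV ξ)
    (hkint : Integrable kV) (x : W) :
    𝓕⁻ (fun ω => (kV ω : ℂ)) (x : V) = 𝓕⁻ (fun ξ => (marginalDensity W kV ξ : ℂ)) x := by
  have hm := (isSpectralDensity_marginalDensity W hkpos hkint).integrable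
  have hG : Continuous fun ξ : W => (𝐞 (inner ℝ ξ x) : ℂ) := by fun_prop
  have hGi : Integrable fun ξ : W => marginalDensity W kV ξ • (𝐞 (inner ℝ ξ x) : ℂ) := by
    simp only [Complex.real_smul]
    exact hm.ofReal.mul_bdd (c := 1) hG.aestronglyMeasurable
      (ae_of_all _ fun ξ => (Circle.norm_coe _).le)
  have h := (integral_smul_comp_orthogonalProjectionOnto (W := W) hkpos hkint
    (G := fun ξ : W => (𝐞 (inner ℝ ξ x) : ℂ)) hG.aestronglyMeasurable
    hGi).2
  rw [Real.fourierInv_eq, Real.fourierInv_eq]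
  simp only [inner_coe_eq_inner_orthogonalProjectionOnto, Circle.smul_def, smul_eq_mul]
  simp only [Complex.real_smul] at h
  simpa only [mul_comm] using h

section Extension

variable {g : W → ℂ}

/-- The Fourier transform of `optimalExtension W kV g`. -/
def extensionHat (W : Submodule ℝ V) (kV : V → ℝ) (g : W → ℂ) (ξ : V) : ℂ :=
  fourierHat g (W.orthogonalProjectionOnto ξ) *
    ((kV ξ / marginalDensity W kV (W.orthogonalProjectionOnto ξ) : ℝ) : ℂ)

theorem extensionHat_eq_smul (ξ : V) :
    extensionHat W kV g ξ = kV ξ • (fun ζ => (marginalDensity W kV ζ)⁻¹ • fourierHat g ζ)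
      (W.orthogonalProjectionOnto ξ) := by
  simp only [extensionHat, Complex.real_smul]
  push_cast
  ring

theorem aestronglyMeasurable_inv_smul (hkpos : ∀ ξ, 0 < kV ξ) (hkint : Integrable kV)
    (hg : MemRKHS (marginalDensity W kV) g) :
    AEStronglyMeasurable fun ζ => (marginalDensity W kV ζ)⁻¹ • fourierHat g ζ :=
  (isSpectralDensity_marginalDensity W hkpos hkint).integrable.aestronglyMeasurable.inv₀.smul
    hg.aestronglyMeasurable_fourierHat

theorem integrable_extensionHat (hkpos : ∀ ξ, 0 < kV ξ) (hkint : Integrable kV)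
    (hg : MemRKHS (marginalDensity W kV) g) : Integrable (extensionHat W kV g) := by
  simp_rw [funext extensionHat_eq_smul]
  refine (integral_smul_comp_orthogonalProjectionOnto hkpos hkint
    (aestronglyMeasurable_inv_smul hkpos hkint hg) (hg.isFourierPair.1.congr ?_)).1
  filter_upwards [(isSpectralDensity_marginalDensity W hkpos hkint).ae_pos] with ζ hζ
  rw [smul_inv_smul₀ hζ.ne']

/-- The extension restricts to `g` on `W`, because its Fourier transform has the marginal `ĝ`. -/
theorem optimalExtension_coe (hkpos : ∀ ξ, 0 < kV ξ) (hkint : Integrable kV)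
    (hg : MemRKHS (marginalDensity W kV) g) (x : W) :
    optimalExtension W kV g (x : V) = g x := by
  have hm := isSpectralDensity_marginalDensity W hkpos hkint
  have hae : (fun ζ => 𝐞 (inner ℝ ζ x) • fourierHat g ζ) =ᵐ[volume] fun ζ =>
      marginalDensity W kV ζ •
        (𝐞 (inner ℝ ζ x) • (marginalDensity W kV ζ)⁻¹ • fourierHat g ζ) := by
    filter_upwards [hm.ae_pos] with ζ hζ
    rw [smul_comm, smul_inv_smul₀ hζ.ne']
  have hi : Integrable fun ζ => 𝐞 (inner ℝ ζ x) • fourierHat g ζ := by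
    simpa using integrable_fourierChar_smul hg.isFourierPair.1 (-x)
  have h := (integral_smul_comp_orthogonalProjectionOnto hkpos hkint
    (G := fun ζ : W => 𝐞 (inner ℝ ζ x) • (marginalDensity W kV ζ)⁻¹ • fourierHat g ζ)
    (aestronglyMeasurable_fourierChar_smul (by fun_prop)
      (aestronglyMeasurable_inv_smul hkpos hkint hg)) (hi.congr hae)).2
  rw [← integral_congr_ae hae, ← Real.fourierInv_eq, ← hg.isFourierPair.2] at h
  rw [← h]
  change 𝓕⁻ (extensionHat W kV g) (x : V) = _
  rw [Real.fourierInv_eq]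
  congr 1; ext ω
  rw [extensionHat_eq_smul, smul_comm, inner_coe_eq_inner_orthogonalProjectionOnto]

/-- The extension has the norm of `g`. -/
theorem integral_extensionHat_sq_div (hkpos : ∀ ξ, 0 < kV ξ) (hkint : Integrable kV)
    (hg : MemRKHS (marginalDensity W kV) g) :
    Integrable (fun ξ => ‖extensionHat W kV g ξ‖ ^ 2 / kV ξ) ∧
      ∫ ξ, ‖extensionHat W kV g ξ‖ ^ 2 / kV ξ = rkhsNormSq (marginalDensity W kV) g := by
  have hm := isSpectralDensity_marginalDensity W hkpos hkint
  have e : (fun ξ => ‖extensionHat W kV g ξ‖ ^ 2 / kV ξ) = fun ξ =>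
      kV ξ • (fun ζ => ‖(marginalDensity W kV ζ)⁻¹ • fourierHat g ζ‖ ^ 2)
        (W.orthogonalProjectionOnto ξ) := by
    ext ξ
    rw [extensionHat_eq_smul, norm_smul, mul_pow, Real.norm_eq_abs, sq_abs, smul_eq_mul]
    have := (hkpos ξ).ne'
    field_simp
  have hae : (fun ζ => ‖fourierHat g ζ‖ ^ 2 / marginalDensity W kV ζ) =ᵐ[volume] fun ζ =>
      marginalDensity W kV ζ • ‖(marginalDensity W kV ζ)⁻¹ • fourierHat g ζ‖ ^ 2 := by
    filter_upwards [hm.ae_pos] with ζ hζ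
    rw [norm_smul, mul_pow, Real.norm_eq_abs, sq_abs, smul_eq_mul]
    field_simp
  have h := integral_smul_comp_orthogonalProjectionOnto hkpos hkint
    (G := fun ζ => ‖(marginalDensity W kV ζ)⁻¹ • fourierHat g ζ‖ ^ 2)
    ((aestronglyMeasurable_inv_smul hkpos hkint hg).norm.pow 2) (hg.2.congr hae)
  rw [e]
  exact ⟨h.1, h.2.trans (integral_congr_ae hae).symm⟩

end Extension

/-! ### Endomorphisms tending to infinity on the complement -/

section Blocks

variable {U : ℕ → V →L[ℝ] V} {U11inf : W →L[ℝ] W}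

theorem orthogonalProjectionOnto_orthogonal_apply_eq_block {T : V →L[ℝ] V}
    (hT : block Wᗮ W T = 0) (v : V) :
    Wᗮ.orthogonalProjectionOnto (T v) = block Wᗮ Wᗮ T (Wᗮ.orthogonalProjectionOnto v) := by
  have h1 : v = (W.orthogonalProjectionOnto v : V) + (Wᗮ.orthogonalProjectionOnto v : V) := by
    simp
  have h2 : Wᗮ.orthogonalProjectionOnto (T (W.orthogonalProjectionOnto v : V)) = 0 :=
    DFunLike.congr_fun hT (W.orthogonalProjectionOnto v)
  conv_lhs => rw [h1, map_add, map_add, h2, zero_add]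
  rfl

theorem apply_coe_eq_block {T : V →L[ℝ] V} (hT : block Wᗮ W T = 0) (v : W) :
    T (v : V) = (block W W T v : V) := by
  have h2 : Wᗮ.orthogonalProjectionOnto (T (v : V)) = 0 := DFunLike.congr_fun hT v
  have h1 : T (v : V) = (W.orthogonalProjectionOnto (T (v : V)) : V)
      + (Wᗮ.orthogonalProjectionOnto (T (v : V)) : V) := by
    simp
  rw [h1, h2, Submodule.coe_zero, add_zero]
  rfl

theorem tendsto_apply_of_orthogonalProjectionOnto_eq_zero
    (hU11 : Tendsto (fun k => block W W (U k)) atTop (𝓝 U11inf))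
    (hU21 : ∀ k, block Wᗮ W (U k) = 0) {v : V} (hv : Wᗮ.orthogonalProjectionOnto v = 0) :
    Tendsto (fun k => U k v) atTop (𝓝 (U11inf (W.orthogonalProjectionOnto v) : V)) := by
  have h1 : v = (W.orthogonalProjectionOnto v : V) := by
    have : v = (W.orthogonalProjectionOnto v : V) + (Wᗮ.orthogonalProjectionOnto v : V) := by
      simp
    conv_lhs => rw [this, hv, Submodule.coe_zero, add_zero]
  have h2 : ∀ k, U k v = (block W W (U k) (W.orthogonalProjectionOnto v) : V) := fun k => by
    rw [← apply_coe_eq_block (hU21 k), ← h1]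
  simp_rw [h2]
  exact (continuous_subtype_val.tendsto _).comp 
    (((ContinuousLinearMap.apply ℝ W _).continuous.tendsto _).comp hU11)

theorem tendsto_apply_cocompact {Lam : ℕ → ℝ} (hLam : Tendsto Lam atTop atTop)
    (hU21 : ∀ k, block Wᗮ W (U k) = 0)
    (hU22 : ∀ k, ∀ x : Wᗮ, Lam k * ‖x‖ ≤ ‖block Wᗮ Wᗮ (U k) x‖)
    {v : V} (hv : Wᗮ.orthogonalProjectionOnto v ≠ 0) :
    Tendsto (fun k => U k v) atTop (cocompact V) := by
  rw [← Metric.cobounded_eq_cocompact, ← tendsto_norm_atTop_iff_cobounded]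
  refine tendsto_atTop_mono (fun k => ?_) (hLam.atTop_mul_const (norm_pos_iff.2 hv))
  refine (hU22 k _).trans ?_
  rw [← orthogonalProjectionOnto_orthogonal_apply_eq_block (hU21 k)]
  exact Submodule.norm_orthogonalProjectionOnto_apply_le _ _

end Blocks

end Decomposition

/-! ### Asymptotic orthogonality of translates -/

section Translates

variable {E : Type*} [NormedAddCommGroup E] [InnerProductSpace ℝ E] [FiniteDimensional ℝ E]
  [MeasurableSpace E] [BorelSpace E] {κ : E → ℝ}

/-- The cross terms of translates are values of an inverse Fourier transform at the difference of
the translations. -/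
theorem integral_inner_fourierChar_smul_div {φ ψ : E → ℂ} (hκ : IsSpectralDensity κ)
    (hφ : AEStronglyMeasurable φ) (hψ : AEStronglyMeasurable ψ)
    (hφ2 : Integrable fun ξ => ‖φ ξ‖ ^ 2 / κ ξ) (hψ2 : Integrable fun ξ => ‖ψ ξ‖ ^ 2 / κ ξ)
    (b c : E) :
    ∫ ξ, inner ℝ (𝐞 (-inner ℝ ξ b) • φ ξ) (𝐞 (-inner ℝ ξ c) • ψ ξ) / κ ξ
      = (𝓕⁻ (fun ξ => ψ ξ * (starRingEnd ℂ) (φ ξ) / (κ ξ : ℂ)) (b - c)).re := by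
  have hi : Integrable fun ξ => ψ ξ * (starRingEnd ℂ) (φ ξ) / (κ ξ : ℂ) := by
    refine (hφ2.add hψ2).mono' ?_ (ae_of_all _ fun ξ => ?_)
    · exact (hψ.mul hφ.star).div₀
        (Complex.continuous_ofReal.comp_aestronglyMeasurable hκ.integrable.aestronglyMeasurable)
    · rw [Pi.add_apply, ← add_div, norm_div, norm_mul, RCLike.norm_conj, Complex.norm_real,
        Real.norm_eq_abs, abs_of_nonneg (hκ.nonneg ξ)]
      gcongr
      · exact hκ.nonneg ξ
      · nlinarith [sq_nonneg (‖φ ξ‖ - ‖ψ ξ‖), sq_nonneg ‖φ ξ‖, sq_nonneg ‖ψ ξ‖]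
  have hi2 := integrable_fourierChar_smul hi (-(b - c))
  simp only [inner_neg_right, neg_neg] at hi2
  rw [Real.fourierInv_eq]
  refine Eq.trans ?_ (integral_re hi2)
  congr 1; ext ξ
  have e1 : 𝐞 (inner ℝ ξ (b - c)) = 𝐞 (-inner ℝ ξ c) * 𝐞 (inner ℝ ξ b) := by
    rw [← AddChar.map_add_eq_mul, inner_sub_right]
    congr 1; ring
  rw [Complex.inner, e1, ← Complex.div_ofReal_re]
  simp only [Circle.smul_def, smul_eq_mul, map_mul, ← Circle.coe_inv_eq_conj,
    ← AddChar.map_neg_eq_inv, neg_neg, Circle.coe_mul]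
  change _ = Complex.re _
  congr 1; ring

/-- Translates of finitely many functions by vectors whose differences tend to infinity are
asymptotically orthogonal, by the Riemann-Lebesgue lemma. -/
theorem tendsto_integral_norm_sum_translates_sq_div {ι : Type*} [DecidableEq ι] {S : Finset ι}
    {φ : ι → E → ℂ} (hκ : IsSpectralDensity κ) (hφ : ∀ i ∈ S, AEStronglyMeasurable (φ i))
    (hφ2 : ∀ i ∈ S, Integrable fun ξ => ‖φ i ξ‖ ^ 2 / κ ξ) {b : ℕ → ι → E}
    (hb : ∀ i ∈ S, ∀ j ∈ S, i ≠ j → Tendsto (fun k => b k i - b k j) atTop (cocompact E)) :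
    (∀ k, Integrable fun ξ => ‖∑ i ∈ S, 𝐞 (-inner ℝ ξ (b k i)) • φ i ξ‖ ^ 2 / κ ξ) ∧
    Tendsto (fun k => ∫ ξ, ‖∑ i ∈ S, 𝐞 (-inner ℝ ξ (b k i)) • φ i ξ‖ ^ 2 / κ ξ) atTop
      (𝓝 (∑ i ∈ S, ∫ ξ, ‖φ i ξ‖ ^ 2 / κ ξ)) := by
  have e : ∀ k, (fun ξ => ‖∑ i ∈ S, 𝐞 (-inner ℝ ξ (b k i)) • φ i ξ‖ ^ 2 / κ ξ) = fun ξ =>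
      ∑ i ∈ S, ∑ j ∈ S, inner ℝ (𝐞 (-inner ℝ ξ (b k i)) • φ i ξ)
        (𝐞 (-inner ℝ ξ (b k j)) • φ j ξ) / κ ξ := fun k => by
    ext ξ
    rw [← real_inner_self_eq_norm_sq, sum_inner, Finset.sum_div]
    refine Finset.sum_congr rfl fun i _ => ?_
    rw [inner_sum, Finset.sum_div]
  have hI : ∀ k, ∀ i ∈ S, ∀ j ∈ S, Integrable fun ξ =>
      inner ℝ (𝐞 (-inner ℝ ξ (b k i)) • φ i ξ) (𝐞 (-inner ℝ ξ (b k j)) • φ j ξ) / κ ξ := by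
    intro k i hi j hj
    refine integrable_inner_div hκ
      (aestronglyMeasurable_fourierChar_smul (by fun_prop) (hφ i hi))
      (aestronglyMeasurable_fourierChar_smul (by fun_prop) (hφ j hj)) ?_ ?_
    · simpa using hφ2 i hi
    · simpa using hφ2 j hj
  refine ⟨fun k => ?_, ?_⟩
  · rw [e k]
    exact integrable_finsetSum _ fun i hi => integrable_finsetSum _ fun j hj => hI k i hi j hj
  · have e2 : ∀ k, ∫ ξ, ‖∑ i ∈ S, 𝐞 (-inner ℝ ξ (b k i)) • φ i ξ‖ ^ 2 / κ ξ
        = ∑ i ∈ S, ∑ j ∈ S, ∫ ξ, inner ℝ (𝐞 (-inner ℝ ξ (b k i)) • φ i ξ)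
        (𝐞 (-inner ℝ ξ (b k j)) • φ j ξ) / κ ξ := fun k => by
      rw [e k, integral_finsetSum _ fun i hi =>
        integrable_finsetSum _ fun j hj => hI k i hi j hj]
      refine Finset.sum_congr rfl fun i hi => ?_
      rw [integral_finsetSum _ fun j hj => hI k i hi j hj]
    have e3 : ∑ i ∈ S, ∫ ξ, ‖φ i ξ‖ ^ 2 / κ ξ
        = ∑ i ∈ S, ∑ j ∈ S, if i = j then ∫ ξ, ‖φ i ξ‖ ^ 2 / κ ξ else 0 := by
      refine Finset.sum_congr rfl fun i hi => ?_
      rw [Finset.sum_ite_eq, if_pos hi]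
    simp_rw [e2]
    rw [e3]
    refine tendsto_finsetSum _ fun i hi => tendsto_finsetSum _ fun j hj => ?_
    split_ifs with hij
    · subst hij
      simp
    · simp_rw [integral_inner_fourierChar_smul_div hκ (hφ i hi) (hφ j hj) (hφ2 i hi) (hφ2 j hj)]
      have := (tendsto_fourierInv_cocompact (fun ξ =>
        φ j ξ * (starRingEnd ℂ) (φ i ξ) / (κ ξ : ℂ))).comp (hb i hi j hj hij)
      have h0 := (Complex.continuous_re.tendsto _).comp this
      rw [Complex.zero_re] at h0
      exact h0

end Translates

/-! ### Sums of indicators of disjoint sets -/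

theorem Finset.sum_indicator_of_mem {ι α M : Type*} [AddCommMonoid M] {S : Finset ι}
    {A : ι → Set α} {u : ι → α → M} {w : α} {j : ι} (hj : j ∈ S) (hw : w ∈ A j)
    (huniq : ∀ i ∈ S, w ∈ A i → i = j) : ∑ i ∈ S, (A i).indicator (u i) w = u j w := by
  rw [Finset.sum_eq_single_of_mem j hj fun i hi hij =>
    Set.indicator_of_notMem (fun h => hij (huniq i hi h)) _, Set.indicator_of_mem hw]

theorem Finset.sum_indicator_of_forall_notMem {ι α M : Type*} [AddCommMonoid M] {S : Finset ι}
    {A : ι → Set α} {u : ι → α → M} {w : α} (hw : ∀ i ∈ S, w ∉ A i) :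
    ∑ i ∈ S, (A i).indicator (u i) w = 0 :=
  Finset.sum_eq_zero fun i hi => Set.indicator_of_notMem (hw i hi) _

/-! ### Atoms and the reduced problems -/

section Reduction

variable {V : Type*} [NormedAddCommGroup V] [InnerProductSpace ℝ V] [FiniteDimensional ℝ V]
  [MeasurableSpace V] [BorelSpace V] {W : Submodule ℝ V} {kV : V → ℝ}
  {Ω : Type*} [MeasurableSpace Ω] {P : Measure Ω} [IsProbabilityMeasure P]
  {X : Ω → V} {Y : Ω → ℂ} {lam : ℝ} {U : ℕ → V →L[ℝ] V} {U11inf : W →L[ℝ] W} {Lam : ℕ → ℝ}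
  {N : ℕ∞} {a : ℕ → Wᗮ} {g : ℕ → W → ℂ} {S : Finset ℕ}

/-- The event that the component of `X` in `Wᗮ` is the `i`-th atom. -/
def atomEvent (W : Submodule ℝ V) (X : Ω → V) (a : ℕ → Wᗮ) (i : ℕ) : Set Ω :=
  {w | Wᗮ.orthogonalProjectionOnto (X w) = a i}

/-- The variable `U₁₁^∞ X_W` of the reduced problems. -/
def reducedVar (U11inf : W →L[ℝ] W) (X : Ω → V) (w : Ω) : W :=
  U11inf (W.orthogonalProjectionOnto (X w))

theorem measurable_orthogonalProjectionOnto_comp (K : Submodule ℝ V) (hX : Measurable X) :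
    Measurable fun w => K.orthogonalProjectionOnto (X w) :=
  K.orthogonalProjectionOnto.continuous.measurable.comp hX

theorem measurableSet_atomEvent (hX : Measurable X) (i : ℕ) :
    MeasurableSet (atomEvent W X a i) :=
  measurable_orthogonalProjectionOnto_comp Wᗮ hX (measurableSet_singleton (a i))

theorem measurable_reducedVar (hX : Measurable X) : Measurable (reducedVar U11inf X) :=
  U11inf.continuous.measurable.comp (measurable_orthogonalProjectionOnto_comp W hX)

theorem atomEvent_unique (ha_inj : Set.InjOn a {i | (i : ℕ∞) < N}) {i j : ℕ}
    (hi : (i : ℕ∞) < N) (hj : (j : ℕ∞) < N) {w : Ω} (hwi : w ∈ atomEvent W X a i)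
    (hwj : w ∈ atomEvent W X a j) : i = j :=
  ha_inj hi hj (Eq.trans (Eq.symm hwi) hwj)

/-! ### The test functions -/

/-- The Fourier transform of the sum of the translated extensions over the indices in `S`. -/
def testHat (W : Submodule ℝ V) (kV : V → ℝ) (a : ℕ → Wᗮ) (g : ℕ → W → ℂ) (T : V →L[ℝ] V)
    (S : Finset ℕ) (ξ : V) : ℂ :=
  ∑ i ∈ S, 𝐞 (-inner ℝ ξ (T (a i : V))) • extensionHat W kV (g i) ξ

theorem testFunction_apply (T : V →L[ℝ] V) (m : ℕ) (x : V) :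
    testFunction W kV N a g T m x = ∑ i ∈ (Finset.range m).filter (fun i : ℕ => (i : ℕ∞) < N),
      optimalExtension W kV (g i) (x - T (a i : V)) := by
  rw [testFunction, Finset.sum_filter]

theorem isFourierPair_testFunction (hkpos : ∀ ξ, 0 < kV ξ) (hkint : Integrable kV)
    (hg : ∀ i : ℕ, (i : ℕ∞) < N → MemRKHS (marginalDensity W kV) (g i)) (T : V →L[ℝ] V)
    (m : ℕ) :
    IsFourierPair (testFunction W kV N a g T m)
      (testHat W kV a g T ((Finset.range m).filter (fun i : ℕ => (i : ℕ∞) < N))) := by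
  have hi : ∀ i ∈ (Finset.range m).filter (fun i : ℕ => (i : ℕ∞) < N), Integrable fun ξ =>
      𝐞 (-inner ℝ ξ (T (a i : V))) • extensionHat W kV (g i) ξ := fun i hi =>
    integrable_fourierChar_smul
      (integrable_extensionHat hkpos hkint (hg i (Finset.mem_filter.1 hi).2)) _
  refine ⟨integrable_finsetSum _ hi, ?_⟩
  ext x
  rw [testFunction_apply, Real.fourierInv_eq]
  have hi2 : ∀ i ∈ (Finset.range m).filter (fun i : ℕ => (i : ℕ∞) < N), Integrable fun ξ =>
      𝐞 (inner ℝ ξ x) • 𝐞 (-inner ℝ ξ (T (a i : V))) • extensionHat W kV (g i) ξ :=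
    fun i h => by simpa using integrable_fourierChar_smul (hi i h) (-x)
  simp_rw [testHat, Finset.smul_sum]
  rw [integral_finsetSum _ hi2]
  refine Finset.sum_congr rfl fun i _ => ?_
  rw [← Real.fourierInv_eq, fourierInv_fourierChar_smul]
  rfl

/-- The norms of the test functions converge, because the translations of distinct atoms
separate. -/
theorem tendsto_rkhsNormSq_testFunction (hkpos : ∀ ξ, 0 < kV ξ) (hkint : Integrable kV)
    (hLam : Tendsto Lam atTop atTop) (hU21 : ∀ k, block Wᗮ W (U k) = 0)
    (hU22 : ∀ k, ∀ x : Wᗮ, Lam k * ‖x‖ ≤ ‖block Wᗮ Wᗮ (U k) x‖)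
    (ha_inj : Set.InjOn a {i | (i : ℕ∞) < N})
    (hg : ∀ i : ℕ, (i : ℕ∞) < N → MemRKHS (marginalDensity W kV) (g i)) (m : ℕ) :
    (∀ k, MemRKHS kV (testFunction W kV N a g (U k) m)) ∧
    Tendsto (fun k => rkhsNormSq kV (testFunction W kV N a g (U k) m)) atTop
      (𝓝 (∑ i ∈ (Finset.range m).filter (fun i : ℕ => (i : ℕ∞) < N),
        rkhsNormSq (marginalDensity W kV) (g i))) := by
  have h := tendsto_integral_norm_sum_translates_sq_div
    (S := (Finset.range m).filter (fun i : ℕ => (i : ℕ∞) < N))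
    (φ := fun i => extensionHat W kV (g i)) (b := fun k i => U k (a i : V))
    (isSpectralDensity_of_pos hkpos hkint)
    (fun i hi => (integrable_extensionHat hkpos hkint
      (hg i (Finset.mem_filter.1 hi).2)).aestronglyMeasurable)
    (fun i hi => (integral_extensionHat_sq_div hkpos hkint (hg i (Finset.mem_filter.1 hi).2)).1)
    (fun i hi j hj hij => by
      simp_rw [← map_sub]
      refine tendsto_apply_cocompact hLam hU21 hU22 ?_
      simp only [map_sub, Submodule.orthogonalProjectionOnto_mem_subspace_eq_self]
      exact sub_ne_zero.2 fun h => hij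
        (ha_inj (Finset.mem_filter.1 hi).2 (Finset.mem_filter.1 hj).2 h))
  have hp := fun k => isFourierPair_testFunction (a := a) hkpos hkint hg (U k) m
  refine ⟨fun k => (hp k).memRKHS (h.1 k), ?_⟩
  simp_rw [fun k => (hp k).rkhsNormSq_eq kV]
  rw [← Finset.sum_congr rfl fun i hi =>
    (integral_extensionHat_sq_div hkpos hkint (hg i (Finset.mem_filter.1 hi).2)).2]
  exact h.2

/-- Each summand of the test function picks out its atom in the limit. -/
theorem tendsto_testFunction_apply (hkpos : ∀ ξ, 0 < kV ξ) (hkint : Integrable kV)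
    (hU11 : Tendsto (fun k => block W W (U k)) atTop (𝓝 U11inf))
    (hLam : Tendsto Lam atTop atTop) (hU21 : ∀ k, block Wᗮ W (U k) = 0)
    (hU22 : ∀ k, ∀ x : Wᗮ, Lam k * ‖x‖ ≤ ‖block Wᗮ Wᗮ (U k) x‖)
    (hg : ∀ i : ℕ, (i : ℕ∞) < N → MemRKHS (marginalDensity W kV) (g i)) (m : ℕ) (w : Ω) :
    Tendsto (fun k => testFunction W kV N a g (U k) m (U k (X w))) atTop
      (𝓝 (∑ i ∈ (Finset.range m).filter (fun i : ℕ => (i : ℕ∞) < N),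
        (atomEvent W X a i).indicator (fun w => g i (reducedVar U11inf X w)) w)) := by
  simp_rw [testFunction_apply, ← map_sub]
  refine tendsto_finsetSum _ fun i hi => ?_
  have hgi := hg i (Finset.mem_filter.1 hi).2
  by_cases hw : w ∈ atomEvent W X a i
  · have h0 : Wᗮ.orthogonalProjectionOnto (X w - (a i : V)) = 0 := by
      rw [map_sub, Submodule.orthogonalProjectionOnto_mem_subspace_eq_self, sub_eq_zero]
      exact hw
    have h1 := tendsto_apply_of_orthogonalProjectionOnto_eq_zero hU11 hU21 h0
    have h2 : W.orthogonalProjectionOnto (X w - (a i : V)) = W.orthogonalProjectionOnto (X w) := by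
      rw [map_sub, Submodule.orthogonalProjectionOnto_apply_of_mem_orthogonal (a i).2, sub_zero]
    rw [h2] at h1
    rw [Set.indicator_of_mem hw, reducedVar, ← optimalExtension_coe hkpos hkint hgi]
    exact ((continuous_fourierInv_of_integrable
      (integrable_extensionHat hkpos hkint hgi)).tendsto _).comp h1
  · rw [Set.indicator_of_notMem hw]
    have h0 : Wᗮ.orthogonalProjectionOnto (X w - (a i : V)) ≠ 0 := by
      rw [map_sub, Submodule.orthogonalProjectionOnto_mem_subspace_eq_self, sub_ne_zero]
      exact hw
    exact (tendsto_fourierInv_cocompact _).comp (tendsto_apply_cocompact hLam hU21 hU22 h0)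

theorem norm_testFunction_le (T : V →L[ℝ] V) (m : ℕ) (x : V) :
    ‖testFunction W kV N a g T m x‖
      ≤ ∑ i ∈ (Finset.range m).filter (fun i : ℕ => (i : ℕ∞) < N),
        ∫ ξ, ‖extensionHat W kV (g i) ξ‖ := by
  rw [testFunction_apply]
  exact (norm_sum_le _ _).trans
    (Finset.sum_le_sum fun i _ => norm_fourierInv_le_integral_norm (extensionHat W kV (g i)) _)

/-- The reduction of the squared error that the minimizer `g i` achieves on its atom, net of its
penalty: the loss of the zero function minus the minimal loss, times two. -/
def lossReduction (P : Measure Ω) (X : Ω → V) (Y : Ω → ℂ) (kV : V → ℝ) (lam : ℝ)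
    (U11inf : W →L[ℝ] W) (a : ℕ → Wᗮ) (g : ℕ → W → ℂ) (i : ℕ) : ℝ :=
  ∫ w in atomEvent W X a i, ‖Y w‖ ^ 2 ∂P - 2 * ridgeLoss (P.restrict (atomEvent W X a i))
    (reducedVar U11inf X) Y (marginalDensity W kV) lam (g i)

theorem tendsto_ridgeLoss_testFunction (hX : Measurable X) (hY : MemLp Y 2 P)
    (hkpos : ∀ ξ, 0 < kV ξ) (hkint : Integrable kV)
    (hU11 : Tendsto (fun k => block W W (U k)) atTop (𝓝 U11inf))
    (hLam : Tendsto Lam atTop atTop) (hU21 : ∀ k, block Wᗮ W (U k) = 0)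
    (hU22 : ∀ k, ∀ x : Wᗮ, Lam k * ‖x‖ ≤ ‖block Wᗮ Wᗮ (U k) x‖)
    (ha_inj : Set.InjOn a {i | (i : ℕ∞) < N})
    (hg : ∀ i : ℕ, (i : ℕ∞) < N → MemRKHS (marginalDensity W kV) (g i)) (m : ℕ) :
    Tendsto (fun k => 2 * ridgeLoss P (fun w => U k (X w)) Y kV lam
        (testFunction W kV N a g (U k) m)) atTop
      (𝓝 (∫ w, ‖Y w‖ ^ 2 ∂P - ∑ i ∈ (Finset.range m).filter (fun i : ℕ => (i : ℕ∞) < N),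
        lossReduction P X Y kV lam U11inf a g i)) := by
  set S := (Finset.range m).filter (fun i : ℕ => (i : ℕ∞) < N) with hS
  have hSN : ∀ i ∈ S, (i : ℕ∞) < N := fun i hi => (Finset.mem_filter.1 hi).2
  obtain ⟨hmem, hnorm⟩ :=
    tendsto_rkhsNormSq_testFunction hkpos hkint hLam hU21 hU22 ha_inj hg m
  have hdata : Tendsto (fun k => ∫ w, ‖Y w - testFunction W kV N a g (U k) m (U k (X w))‖ ^ 2 ∂P)
      atTop (𝓝 (∫ w, ‖Y w - ∑ i ∈ S,
        (atomEvent W X a i).indicator (fun w => g i (reducedVar U11inf X w)) w‖ ^ 2 ∂P)) := by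
    set B := ∑ i ∈ S, ∫ ξ, ‖extensionHat W kV (g i) ξ‖
    refine tendsto_integral_of_dominated_convergence (fun w => 2 * ‖Y w‖ ^ 2 + 2 * B ^ 2)
      (fun k => ?_) ((hY.integrable_norm_sq.const_mul 2).add (integrable_const _)) (fun k => ?_) ?_
    · exact (hY.sub ((hmem k).memLp_comp
        ((U k).continuous.measurable.comp hX))).integrable_norm_sq.aestronglyMeasurable
    · refine ae_of_all _ fun w => ?_
      have h1 := norm_testFunction_le (N := N) (a := a) (g := g) (kV := kV) (U k) m (U k (X w))
      have h2 := norm_sub_le (Y w) (testFunction W kV N a g (U k) m (U k (X w)))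
      rw [Real.norm_eq_abs, abs_of_nonneg (sq_nonneg _)]
      have h3 : ‖Y w - testFunction W kV N a g (U k) m (U k (X w))‖ ≤ ‖Y w‖ + B :=
        h2.trans (by gcongr)
      calc _ ≤ (‖Y w‖ + B) ^ 2 := by gcongr
        _ ≤ _ := by nlinarith [sq_nonneg (‖Y w‖ - B)]
    · refine ae_of_all _ fun w => ?_
      exact ((tendsto_const_nhds.sub (tendsto_testFunction_apply hkpos hkint hU11 hLam hU21 hU22
        hg m w)).norm.pow 2)
  have hval : ∫ w, ‖Y w - ∑ i ∈ S,
        (atomEvent W X a i).indicator (fun w => g i (reducedVar U11inf X w)) w‖ ^ 2 ∂P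
      = ∫ w, ‖Y w‖ ^ 2 ∂P - ∑ i ∈ S, (∫ w in atomEvent W X a i, ‖Y w‖ ^ 2 ∂P
        - ∫ w in atomEvent W X a i, ‖Y w - g i (reducedVar U11inf X w)‖ ^ 2 ∂P) := by
    have hZ : Measurable (reducedVar U11inf X) := measurable_reducedVar hX
    have hi1 : Integrable (fun w => ‖Y w‖ ^ 2) P := hY.integrable_norm_sq
    have hi2 : ∀ i ∈ S, Integrable (fun w => ‖Y w - g i (reducedVar U11inf X w)‖ ^ 2) P :=
      fun i hi => (hY.sub ((hg i (hSN i hi)).memLp_comp hZ)).integrable_norm_sq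
    have hpt : ∀ w, ‖Y w - ∑ i ∈ S,
        (atomEvent W X a i).indicator (fun w => g i (reducedVar U11inf X w)) w‖ ^ 2
        = ‖Y w‖ ^ 2 - ∑ i ∈ S, (atomEvent W X a i).indicator
          (fun w => ‖Y w‖ ^ 2 - ‖Y w - g i (reducedVar U11inf X w)‖ ^ 2) w := by
      intro w
      by_cases hw : ∃ j ∈ S, w ∈ atomEvent W X a j
      · obtain ⟨j, hj, hwj⟩ := hw
        have hu : ∀ i ∈ S, w ∈ atomEvent W X a i → i = j := fun i hi hwi =>
          atomEvent_unique ha_inj (hSN i hi) (hSN j hj) hwi hwj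
        rw [Finset.sum_indicator_of_mem hj hwj hu, Finset.sum_indicator_of_mem hj hwj hu]
        ring
      · push Not at hw
        rw [Finset.sum_indicator_of_forall_notMem hw, Finset.sum_indicator_of_forall_notMem hw]
        simp
    simp_rw [hpt]
    have hi3 : ∀ i ∈ S, Integrable ((atomEvent W X a i).indicator
        (fun w => ‖Y w‖ ^ 2 - ‖Y w - g i (reducedVar U11inf X w)‖ ^ 2)) P := fun i hi =>
      (hi1.sub (hi2 i hi)).indicator (measurableSet_atomEvent hX i)
    rw [integral_sub hi1 (integrable_finsetSum _ hi3), integral_finsetSum _ hi3]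
    congr 1
    refine Finset.sum_congr rfl fun i hi => ?_
    rw [integral_indicator (measurableSet_atomEvent hX i),
      integral_sub hi1.integrableOn (hi2 i hi).integrableOn]
  have h := hdata.add (hnorm.const_mul lam)
  rw [hval] at h
  have hlim : ∫ w, ‖Y w‖ ^ 2 ∂P - ∑ i ∈ S, lossReduction P X Y kV lam U11inf a g i
      = ∫ w, ‖Y w‖ ^ 2 ∂P - ∑ i ∈ S, (∫ w in atomEvent W X a i, ‖Y w‖ ^ 2 ∂P
        - ∫ w in atomEvent W X a i, ‖Y w - g i (reducedVar U11inf X w)‖ ^ 2 ∂P)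
        + lam * ∑ i ∈ S, rkhsNormSq (marginalDensity W kV) (g i) := by
    rw [Finset.mul_sum, sub_add, ← Finset.sum_sub_distrib]
    congr 1
    refine Finset.sum_congr rfl fun i _ => ?_
    unfold lossReduction ridgeLoss
    ring
  rw [hlim]
  refine h.congr fun k => ?_
  unfold ridgeLoss
  ring

end Reduction

section Dual

variable {V : Type*} [NormedAddCommGroup V] [InnerProductSpace ℝ V] [FiniteDimensional ℝ V]
  [MeasurableSpace V] [BorelSpace V] {W : Submodule ℝ V} {kV : V → ℝ}
  {Ω : Type*} [MeasurableSpace Ω] {P : Measure Ω} [IsProbabilityMeasure P]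
  {X : Ω → V} {Y : Ω → ℂ} {lam : ℝ} {U : ℕ → V →L[ℝ] V} {U11inf : W →L[ℝ] W} {Lam : ℕ → ℝ}
  {N : ℕ∞} {a : ℕ → Wᗮ} {g : ℕ → W → ℂ} {S : Finset ℕ}

/-! ### The dual certificate -/

/-- The event that the component of `X` in `Wᗮ` is not an atom. -/
def atomlessEvent (W : Submodule ℝ V) (X : Ω → V) (N : ℕ∞) (a : ℕ → Wᗮ) : Set Ω :=
  {w | ∀ i : ℕ, (i : ℕ∞) < N → w ∉ atomEvent W X a i}

/-- The event that the component of `X` in `Wᗮ` is an atom with index outside `S`. -/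
def remainingEvent (W : Submodule ℝ V) (X : Ω → V) (N : ℕ∞) (a : ℕ → Wᗮ) (S : Finset ℕ) : Set Ω :=
  {w | ∃ i : ℕ, i ∉ S ∧ (i : ℕ∞) < N ∧ w ∈ atomEvent W X a i}

theorem measurableSet_remainingEvent (hX : Measurable X) :
    MeasurableSet (remainingEvent W X N a S) := by
  have : remainingEvent W X N a S
      = ⋃ i : ℕ, ⋃ _ : i ∉ S, ⋃ _ : (i : ℕ∞) < N, atomEvent W X a i := by
    ext w
    simp only [remainingEvent, Set.mem_ofPred_eq, Set.mem_iUnion, exists_prop]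
  rw [this]
  exact MeasurableSet.iUnion fun i => MeasurableSet.iUnion fun _ => MeasurableSet.iUnion fun _ =>
    measurableSet_atomEvent hX i

theorem measurableSet_atomlessEvent (hX : Measurable X) :
    MeasurableSet (atomlessEvent W X N a) := by
  have : atomlessEvent W X N a = ⋂ i : ℕ, ⋂ _ : (i : ℕ∞) < N, (atomEvent W X a i)ᶜ := by
    ext w; simp [atomlessEvent]
  rw [this]
  exact MeasurableSet.iInter fun i => MeasurableSet.iInter fun _ =>
    (measurableSet_atomEvent hX i).compl

/-- The dual variable that bounds the minimal losses from below: the response itself where there is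
no atom, the residual of the reduced problem on the atoms in `S`, and zero on the other atoms. -/
def dualResidual (X : Ω → V) (Y : Ω → ℂ) (U11inf : W →L[ℝ] W) (N : ℕ∞) (a : ℕ → Wᗮ)
    (g : ℕ → W → ℂ) (S : Finset ℕ) (w : Ω) : ℂ :=
  (atomlessEvent W X N a).indicator Y w + ∑ i ∈ S,
    (atomEvent W X a i).indicator (fun w => Y w - g i (reducedVar U11inf X w)) w

theorem dualResidual_of_mem (ha_inj : Set.InjOn a {i | (i : ℕ∞) < N})
    (hSN : ∀ i ∈ S, (i : ℕ∞) < N) {j : ℕ} (hj : j ∈ S) {w : Ω} (hw : w ∈ atomEvent W X a j) :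
    dualResidual X Y U11inf N a g S w = Y w - g j (reducedVar U11inf X w) := by
  rw [dualResidual, Finset.sum_indicator_of_mem hj hw fun i hi hwi =>
    atomEvent_unique ha_inj (hSN i hi) (hSN j hj) hwi hw,
    Set.indicator_of_notMem fun h : w ∈ atomlessEvent W X N a => h j (hSN j hj) hw, zero_add]

theorem notMem_atomEvent_of_mem_remainingEvent (ha_inj : Set.InjOn a {i | (i : ℕ∞) < N})
    (hSN : ∀ i ∈ S, (i : ℕ∞) < N) {w : Ω} (hw : w ∈ remainingEvent W X N a S) :
    ∀ i ∈ S, w ∉ atomEvent W X a i := by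
  obtain ⟨j, hj, hjN, hwj⟩ := hw
  exact fun i hi hwi => hj (atomEvent_unique ha_inj (hSN i hi) hjN hwi hwj ▸ hi)

theorem dualResidual_of_mem_remainingEvent (ha_inj : Set.InjOn a {i | (i : ℕ∞) < N})
    (hSN : ∀ i ∈ S, (i : ℕ∞) < N) {w : Ω} (hw : w ∈ remainingEvent W X N a S) :
    dualResidual X Y U11inf N a g S w = 0 := by
  rw [dualResidual, Finset.sum_indicator_of_forall_notMem
    (notMem_atomEvent_of_mem_remainingEvent ha_inj hSN hw), add_zero]
  obtain ⟨j, hj, hjN, hwj⟩ := hw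
  exact Set.indicator_of_notMem (fun h : w ∈ atomlessEvent W X N a => h j hjN hwj) _

theorem dualResidual_of_mem_atomlessEvent (hSN : ∀ i ∈ S, (i : ℕ∞) < N) {w : Ω}
    (hw : w ∈ atomlessEvent W X N a) : dualResidual X Y U11inf N a g S w = Y w := by
  rw [dualResidual, Finset.sum_indicator_of_forall_notMem fun i hi => hw i (hSN i hi), add_zero,
    Set.indicator_of_mem hw]

theorem memLp_dualResidual (hX : Measurable X) (hY : MemLp Y 2 P)
    (hg : ∀ i ∈ S, MemRKHS (marginalDensity W kV) (g i)) :
    MemLp (dualResidual X Y U11inf N a g S) 2 P := by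
  refine MemLp.add (hY.indicator (measurableSet_atomlessEvent hX))
    (memLp_finsetSum _ fun i hi => ?_)
  exact (hY.sub ((hg i hi).memLp_comp (measurable_reducedVar hX))).indicator
    (measurableSet_atomEvent hX i)

theorem mem_cases (N : ℕ∞) (a : ℕ → Wᗮ) (S : Finset ℕ) (w : Ω) :
    (∃ j ∈ S, w ∈ atomEvent W X a j) ∨ w ∈ remainingEvent W X N a S ∨
      w ∈ atomlessEvent W X N a := by
  by_cases h1 : ∃ j ∈ S, w ∈ atomEvent W X a j
  · exact Or.inl h1
  · push Not at h1
    by_cases h2 : w ∈ remainingEvent W X N a S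
    · exact Or.inr (Or.inl h2)
    · exact Or.inr (Or.inr fun i hi hw => h2 ⟨i, fun h => h1 i h hw, hi, hw⟩)

theorem integral_norm_sub_dualResidual_sq (hX : Measurable X) (hY : MemLp Y 2 P)
    (ha_inj : Set.InjOn a {i | (i : ℕ∞) < N}) (hSN : ∀ i ∈ S, (i : ℕ∞) < N)
    (hg : ∀ i ∈ S, MemRKHS (marginalDensity W kV) (g i)) :
    ∫ w, ‖Y w - dualResidual X Y U11inf N a g S w‖ ^ 2 ∂P
      = ∫ w in remainingEvent W X N a S, ‖Y w‖ ^ 2 ∂P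
        + ∑ i ∈ S, ∫ w in atomEvent W X a i, ‖g i (reducedVar U11inf X w)‖ ^ 2 ∂P := by
  have hpt : ∀ w, ‖Y w - dualResidual X Y U11inf N a g S w‖ ^ 2
      = (remainingEvent W X N a S).indicator (fun w => ‖Y w‖ ^ 2) w
        + ∑ i ∈ S, (atomEvent W X a i).indicator
          (fun w => ‖g i (reducedVar U11inf X w)‖ ^ 2) w := by
    intro w
    rcases mem_cases N a S w with ⟨j, hj, hw⟩ | hw | hw
    · rw [dualResidual_of_mem ha_inj hSN hj hw, Finset.sum_indicator_of_mem hj hw fun i hi hwi =>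
        atomEvent_unique ha_inj (hSN i hi) (hSN j hj) hwi hw, Set.indicator_of_notMem fun h =>
        notMem_atomEvent_of_mem_remainingEvent ha_inj hSN h j hj hw, zero_add, sub_sub_cancel]
    · rw [dualResidual_of_mem_remainingEvent ha_inj hSN hw, Finset.sum_indicator_of_forall_notMem
        (notMem_atomEvent_of_mem_remainingEvent ha_inj hSN hw), Set.indicator_of_mem hw, sub_zero,
        add_zero]
    · rw [dualResidual_of_mem_atomlessEvent hSN hw, Finset.sum_indicator_of_forall_notMem
        fun i hi => hw i (hSN i hi), Set.indicator_of_notMem, sub_self]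
      · simp
      · rintro ⟨j, -, hjN, hwj⟩
        exact hw j hjN hwj
  have hi1 := hY.integrable_norm_sq.indicator (measurableSet_remainingEvent (N := N) (a := a)
    (S := S) hX)
  have hi2 : ∀ i ∈ S, Integrable ((atomEvent W X a i).indicator
      (fun w => ‖g i (reducedVar U11inf X w)‖ ^ 2)) P := fun i hi =>
    ((hg i hi).memLp_comp (measurable_reducedVar hX)).integrable_norm_sq.indicator
      (measurableSet_atomEvent hX i)
  simp_rw [hpt]
  rw [integral_add hi1 (integrable_finsetSum _ hi2), integral_finsetSum _ hi2,
    integral_indicator (measurableSet_remainingEvent hX)]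
  congr 1
  exact Finset.sum_congr rfl fun i _ => integral_indicator (measurableSet_atomEvent hX i)

/-- The kernel averages of the dual residual converge to the reduced minimizers on the atoms in
`S`, and to zero off the atoms. -/
theorem tendsto_kernel_average_dualResidual (hX : Measurable X) (hY : MemLp Y 2 P)
    (hlam : 0 < lam) (hkpos : ∀ ξ, 0 < kV ξ) (hkint : Integrable kV)
    (hU11 : Tendsto (fun k => block W W (U k)) atTop (𝓝 U11inf))
    (hLam : Tendsto Lam atTop atTop) (hU21 : ∀ k, block Wᗮ W (U k) = 0)
    (hU22 : ∀ k, ∀ x : Wᗮ, Lam k * ‖x‖ ≤ ‖block Wᗮ Wᗮ (U k) x‖)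
    (ha_inj : Set.InjOn a {i | (i : ℕ∞) < N})
    (ha : a '' {i | (i : ℕ∞) < N} = {y | P {w | Wᗮ.orthogonalProjectionOnto (X w) = y} ≠ 0})
    (hSN : ∀ i ∈ S, (i : ℕ∞) < N)
    (hg : ∀ i ∈ S, IsRidgeMinimizer (P.restrict (atomEvent W X a i)) (reducedVar U11inf X) Y
      (marginalDensity W kV) lam (g i)) (w : Ω) (hw : w ∉ remainingEvent W X N a S) :
    Tendsto (fun k => ∫ w', 𝓕⁻ (fun ξ => (kV ξ : ℂ)) (U k (X w) - U k (X w'))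
        * dualResidual X Y U11inf N a g S w' ∂P) atTop
      (𝓝 (∑ i ∈ S, (atomEvent W X a i).indicator
        (fun w => (lam : ℂ) * g i (reducedVar U11inf X w)) w)) := by
  set ρ := dualResidual X Y U11inf N a g S with hρdef
  set K := 𝓕⁻ (fun ξ => (kV ξ : ℂ)) with hK
  have hKc : Continuous K := continuous_fourierInv_of_integrable hkint.ofReal
  have hρ : Integrable ρ P :=
    (memLp_dualResidual hX hY fun i hi => (hg i hi).1).integrable (by norm_num)
  -- the kernel is bounded, so pointwise convergence of the integrand suffices
  have hdct : ∀ {G : Ω → ℂ}, (∀ᵐ w' ∂P, Tendsto (fun k => K (U k (X w) - U k (X w')) * ρ w') atTop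
      (𝓝 (G w'))) → Tendsto (fun k => ∫ w', K (U k (X w) - U k (X w')) * ρ w' ∂P) atTop
      (𝓝 (∫ w', G w' ∂P)) := fun {G} hG => by
    refine tendsto_integral_of_dominated_convergence
      (fun w' => (∫ ξ, ‖(kV ξ : ℂ)‖) * ‖ρ w'‖) (fun k => ?_) (hρ.norm.const_mul _)
      (fun k => ae_of_all _ fun w' => ?_) hG
    · refine AEStronglyMeasurable.mul ?_ hρ.aestronglyMeasurable
      exact (hKc.measurable.comp (measurable_const.sub
        ((U k).continuous.measurable.comp hX))).aestronglyMeasurable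
    · rw [norm_mul]
      gcongr
      exact norm_fourierInv_le_integral_norm _ _
  have hfar : ∀ w', Wᗮ.orthogonalProjectionOnto (X w') ≠ Wᗮ.orthogonalProjectionOnto (X w) →
      Tendsto (fun k => K (U k (X w) - U k (X w')) * ρ w') atTop (𝓝 0) := fun w' hw' => by
    have h0 : Wᗮ.orthogonalProjectionOnto (X w - X w') ≠ 0 := by
      rw [map_sub, sub_ne_zero]
      exact fun h => hw' h.symm
    simp_rw [← map_sub]
    simpa using ((tendsto_fourierInv_cocompact (fun ξ => (kV ξ : ℂ))).comp
      (tendsto_apply_cocompact hLam hU21 hU22 h0)).mul_const (ρ w')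
  rcases mem_cases N a S w with ⟨j, hj, hwj⟩ | hw' | hw'
  · rw [Finset.sum_indicator_of_mem hj hwj fun i hi hwi =>
        atomEvent_unique ha_inj (hSN i hi) (hSN j hj) hwi hwj]
    have hZ : Measurable (reducedVar U11inf X) := measurable_reducedVar hX
    rw [(hg j hj).lam_mul_eq (isSpectralDensity_marginalDensity W hkpos hkint) hlam hZ
      (hY.mono_measure Measure.restrict_le_self),
      ← integral_indicator (measurableSet_atomEvent hX j)]
    refine hdct (ae_of_all _ fun w' => ?_)
    by_cases hwj' : w' ∈ atomEvent W X a j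
    · rw [Set.indicator_of_mem hwj']
      have h0 : Wᗮ.orthogonalProjectionOnto (X w - X w') = 0 := by
        rw [map_sub, sub_eq_zero]
        exact Eq.trans hwj (Eq.symm hwj')
      have h1 := tendsto_apply_of_orthogonalProjectionOnto_eq_zero hU11 hU21 h0
      simp_rw [map_sub] at h1
      rw [← fourierInv_coe_eq_fourierInv_marginalDensity hkpos hkint,
        hρdef, dualResidual_of_mem ha_inj hSN hj hwj']
      exact ((hKc.tendsto _).comp h1).mul_const _
    · rw [Set.indicator_of_notMem hwj']
      exact hfar w' fun h => hwj' (Eq.trans h hwj)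
  · exact absurd hw' hw
  · rw [Finset.sum_indicator_of_forall_notMem fun i hi => hw' i (hSN i hi),
      ← integral_zero Ω ℂ (μ := P)]
    refine hdct ?_
    have hnull : P {w' | Wᗮ.orthogonalProjectionOnto (X w') = Wᗮ.orthogonalProjectionOnto (X w)}
        = 0 := by
      by_contra hne
      have hmem : Wᗮ.orthogonalProjectionOnto (X w) ∈ a '' {i | (i : ℕ∞) < N} := by
        rw [ha]; exact hne
      obtain ⟨i, hi, hai⟩ := hmem
      exact hw' i hi hai.symm
    filter_upwards [measure_eq_zero_iff_ae_notMem.1 hnull] with w' h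
    exact hfar w' h

theorem tendsto_integral_mul_featureMean_dualResidual_sq (hX : Measurable X) (hY : MemLp Y 2 P)
    (hlam : 0 < lam) (hkpos : ∀ ξ, 0 < kV ξ) (hkint : Integrable kV)
    (hU11 : Tendsto (fun k => block W W (U k)) atTop (𝓝 U11inf))
    (hLam : Tendsto Lam atTop atTop) (hU21 : ∀ k, block Wᗮ W (U k) = 0)
    (hU22 : ∀ k, ∀ x : Wᗮ, Lam k * ‖x‖ ≤ ‖block Wᗮ Wᗮ (U k) x‖)
    (ha_inj : Set.InjOn a {i | (i : ℕ∞) < N})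
    (ha : a '' {i | (i : ℕ∞) < N} = {y | P {w | Wᗮ.orthogonalProjectionOnto (X w) = y} ≠ 0})
    (hSN : ∀ i ∈ S, (i : ℕ∞) < N)
    (hg : ∀ i ∈ S, IsRidgeMinimizer (P.restrict (atomEvent W X a i)) (reducedVar U11inf X) Y
      (marginalDensity W kV) lam (g i)) :
    Tendsto (fun k => ∫ ξ, kV ξ *
        ‖featureMean P (fun w => U k (X w)) (dualResidual X Y U11inf N a g S) ξ‖ ^ 2) atTop
      (𝓝 (∑ i ∈ S, ∫ w in atomEvent W X a i, inner ℝ (Y w - g i (reducedVar U11inf X w))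
        ((lam : ℂ) * g i (reducedVar U11inf X w)) ∂P)) := by
  set ρ := dualResidual X Y U11inf N a g S with hρdef
  have hκ := isSpectralDensity_of_pos hkpos hkint
  have hZ : Measurable (reducedVar U11inf X) := measurable_reducedVar hX
  have hρ2 : MemLp ρ 2 P := memLp_dualResidual hX hY fun i hi => (hg i hi).1
  have hρ : Integrable ρ P := hρ2.integrable (by norm_num)
  have hUX : ∀ k, Measurable fun w => U k (X w) := fun k => (U k).continuous.measurable.comp hX
  simp_rw [fun k => integral_mul_featureMean_sq hκ (hUX k) hρ]
  have hlim : ∑ i ∈ S, ∫ w in atomEvent W X a i, inner ℝ (Y w - g i (reducedVar U11inf X w))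
        ((lam : ℂ) * g i (reducedVar U11inf X w)) ∂P
      = ∫ w, ∑ i ∈ S, (atomEvent W X a i).indicator (fun w =>
        (inner ℝ (Y w - g i (reducedVar U11inf X w))
          ((lam : ℂ) * g i (reducedVar U11inf X w)) : ℝ)) w ∂P := by
    rw [integral_finsetSum]
    · exact Finset.sum_congr rfl fun i _ =>
        (integral_indicator (measurableSet_atomEvent hX i)).symm
    · intro i hi
      have hgi : MemLp (fun w => g i (reducedVar U11inf X w)) 2 P := (hg i hi).1.memLp_comp hZ
      exact ((hY.sub hgi).integrable_real_inner (hgi.const_mul (lam : ℂ))).indicator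
        (measurableSet_atomEvent hX i)
  rw [hlim]
  refine tendsto_integral_of_dominated_convergence
    (fun w => ‖ρ w‖ * ((∫ ξ, ‖(kV ξ : ℂ)‖) * ∫ w', ‖ρ w'‖ ∂P)) (fun k => ?_)
    (hρ.norm.mul_const _) (fun k => ae_of_all _ fun w => ?_) (ae_of_all _ fun w => ?_)
  · simp_rw [← fourierInv_mul_featureMean hκ (hUX k) hρ]
    exact hρ.aestronglyMeasurable.inner ((continuous_fourierInv_of_integrable
      (hκ.integrable_mul_featureMean (hUX k) hρ)).measurable.comp (hUX k)).aestronglyMeasurable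
  · refine (norm_inner_le_norm _ _).trans ?_
    gcongr
    refine (norm_integral_le_integral_norm _).trans ?_
    rw [← integral_const_mul]
    refine integral_mono_of_nonneg (ae_of_all _ fun _ => norm_nonneg _) (hρ.norm.const_mul _)
      (ae_of_all _ fun w' => ?_)
    exact (norm_mul_le _ _).trans (mul_le_mul_of_nonneg_right
      (norm_fourierInv_le_integral_norm _ _) (norm_nonneg _))
  · by_cases hw : w ∈ remainingEvent W X N a S
    · rw [hρdef, dualResidual_of_mem_remainingEvent ha_inj hSN hw,
        Finset.sum_indicator_of_forall_notMem
          (notMem_atomEvent_of_mem_remainingEvent ha_inj hSN hw)]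
      simp
    · have h := (tendsto_const_nhds (x := ρ w)).inner (𝕜 := ℝ)
        (tendsto_kernel_average_dualResidual hX hY hlam hkpos hkint hU11 hLam hU21 hU22 ha_inj ha
          hSN hg w hw)
      have hval : ∑ i ∈ S, (atomEvent W X a i).indicator (fun w =>
          (inner ℝ (Y w - g i (reducedVar U11inf X w))
            ((lam : ℂ) * g i (reducedVar U11inf X w)) : ℝ)) w
          = inner ℝ (ρ w) (∑ i ∈ S, (atomEvent W X a i).indicator
            (fun w => (lam : ℂ) * g i (reducedVar U11inf X w)) w) := by
        by_cases hw2 : ∃ j ∈ S, w ∈ atomEvent W X a j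
        · obtain ⟨j, hj, hwj⟩ := hw2
          have hu : ∀ i ∈ S, w ∈ atomEvent W X a i → i = j := fun i hi hwi =>
            atomEvent_unique ha_inj (hSN i hi) (hSN j hj) hwi hwj
          rw [Finset.sum_indicator_of_mem hj hwj hu, Finset.sum_indicator_of_mem hj hwj hu,
            hρdef, dualResidual_of_mem ha_inj hSN hj hwj]
        · push Not at hw2
          rw [Finset.sum_indicator_of_forall_notMem hw2,
            Finset.sum_indicator_of_forall_notMem hw2, inner_zero_right]
      rw [hval]
      exact h

theorem lossReduction_eq (hX : Measurable X) (hY : MemLp Y 2 P)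
    (hlam : 0 < lam) (hkpos : ∀ ξ, 0 < kV ξ) (hkint : Integrable kV) {i : ℕ}
    (hg : IsRidgeMinimizer (P.restrict (atomEvent W X a i)) (reducedVar U11inf X) Y
      (marginalDensity W kV) lam (g i)) :
    lossReduction P X Y kV lam U11inf a g i
      = ∫ w in atomEvent W X a i, ‖g i (reducedVar U11inf X w)‖ ^ 2 ∂P
        + 1 / lam * ∫ w in atomEvent W X a i, inner ℝ (Y w - g i (reducedVar U11inf X w))
          ((lam : ℂ) * g i (reducedVar U11inf X w)) ∂P := by
  have hZ : Measurable (reducedVar U11inf X) := measurable_reducedVar hX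
  have hY' : MemLp Y 2 (P.restrict (atomEvent W X a i)) :=
    hY.mono_measure Measure.restrict_le_self
  have hgm : MemLp (fun w => g i (reducedVar U11inf X w)) 2 (P.restrict (atomEvent W X a i)) :=
    hg.1.memLp_comp hZ
  have h1 := hg.rkhsInner_eq (isSpectralDensity_marginalDensity W hkpos hkint) hlam hZ hY' hg.1
  rw [rkhsInner_self] at h1
  have h2 := integral_norm_add_smul_sq (hY'.sub hgm) hgm 1
  simp only [Pi.sub_apply, one_smul, sub_add_cancel] at h2
  have h3 : ∫ w in atomEvent W X a i, inner ℝ (Y w - g i (reducedVar U11inf X w))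
      ((lam : ℂ) * g i (reducedVar U11inf X w)) ∂P = lam * ∫ w in atomEvent W X a i,
        inner ℝ (Y w - g i (reducedVar U11inf X w)) (g i (reducedVar U11inf X w)) ∂P := by
    rw [← integral_const_mul]
    simp_rw [← Complex.real_smul, real_inner_smul_right]
  rw [h3, lossReduction, ridgeLoss, h2]
  have h4 : 1 / lam * (lam * ∫ w in atomEvent W X a i,
      inner ℝ (Y w - g i (reducedVar U11inf X w)) (g i (reducedVar U11inf X w)) ∂P)
      = ∫ w in atomEvent W X a i,
      inner ℝ (Y w - g i (reducedVar U11inf X w)) (g i (reducedVar U11inf X w)) ∂P := by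
    field_simp
  rw [h4]
  linarith

theorem lossReduction_mem_Icc (hX : Measurable X) (hY : MemLp Y 2 P)
    (hlam : 0 < lam) (hkpos : ∀ ξ, 0 < kV ξ) (hkint : Integrable kV) {i : ℕ}
    (hg : IsRidgeMinimizer (P.restrict (atomEvent W X a i)) (reducedVar U11inf X) Y
      (marginalDensity W kV) lam (g i)) :
    lossReduction P X Y kV lam U11inf a g i
      ∈ Set.Icc 0 (∫ w in atomEvent W X a i, ‖Y w‖ ^ 2 ∂P) := by
  have hm := isSpectralDensity_marginalDensity W hkpos hkint
  have hZ : Measurable (reducedVar U11inf X) := measurable_reducedVar hX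
  have hY' : MemLp Y 2 (P.restrict (atomEvent W X a i)) :=
    hY.mono_measure Measure.restrict_le_self
  have h1 := hg.rkhsInner_eq hm hlam hZ hY' hg.1
  rw [rkhsInner_self] at h1
  have h2 := rkhsNormSq_nonneg hm (g i)
  constructor
  · rw [lossReduction_eq hX hY hlam hkpos hkint hg]
    simp_rw [← Complex.real_smul, real_inner_smul_right]
    rw [integral_const_mul, ← h1]
    have : 0 ≤ ∫ w in atomEvent W X a i, ‖g i (reducedVar U11inf X w)‖ ^ 2 ∂P :=
      integral_nonneg fun w => sq_nonneg _
    positivity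
  · rw [lossReduction, ridgeLoss]
    have : 0 ≤ ∫ w in atomEvent W X a i, ‖Y w - g i (reducedVar U11inf X w)‖ ^ 2 ∂P :=
      integral_nonneg fun w => sq_nonneg _
    have h3 := mul_nonneg hlam.le h2
    linarith

/-- The minimal losses of the full problems are asymptotically bounded below by the value of the
dual certificate. -/
theorem exists_tendsto_le_ridgeLoss (hX : Measurable X) (hY : MemLp Y 2 P)
    (hlam : 0 < lam) (hkpos : ∀ ξ, 0 < kV ξ) (hkint : Integrable kV)
    (hU11 : Tendsto (fun k => block W W (U k)) atTop (𝓝 U11inf))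
    (hLam : Tendsto Lam atTop atTop) (hU21 : ∀ k, block Wᗮ W (U k) = 0)
    (hU22 : ∀ k, ∀ x : Wᗮ, Lam k * ‖x‖ ≤ ‖block Wᗮ Wᗮ (U k) x‖)
    (ha_inj : Set.InjOn a {i | (i : ℕ∞) < N})
    (ha : a '' {i | (i : ℕ∞) < N} = {y | P {w | Wᗮ.orthogonalProjectionOnto (X w) = y} ≠ 0})
    (hSN : ∀ i ∈ S, (i : ℕ∞) < N)
    (hg : ∀ i ∈ S, IsRidgeMinimizer (P.restrict (atomEvent W X a i)) (reducedVar U11inf X) Y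
      (marginalDensity W kV) lam (g i)) :
    ∃ D : ℕ → ℝ, Tendsto D atTop (𝓝 (∫ w, ‖Y w‖ ^ 2 ∂P
        - ∑ i ∈ S, lossReduction P X Y kV lam U11inf a g i
        - ∫ w in remainingEvent W X N a S, ‖Y w‖ ^ 2 ∂P)) ∧
      ∀ k f, MemRKHS kV f → D k ≤ 2 * ridgeLoss P (fun w => U k (X w)) Y kV lam f := by
  refine ⟨_, ?_, fun k f hf => le_ridgeLoss_of_dual (isSpectralDensity_of_pos hkpos hkint) hlam
    ((U k).continuous.measurable.comp hX) hY hf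
    (memLp_dualResidual (U11inf := U11inf) (N := N) (a := a) hX hY fun i hi => (hg i hi).1)⟩
  have h := (tendsto_integral_mul_featureMean_dualResidual_sq hX hY hlam hkpos hkint hU11 hLam
    hU21 hU22 ha_inj ha hSN hg).const_mul (1 / lam)
  rw [integral_norm_sub_dualResidual_sq hX hY ha_inj hSN fun i hi => (hg i hi).1]
  have hlim : ∫ w, ‖Y w‖ ^ 2 ∂P - ∑ i ∈ S, lossReduction P X Y kV lam U11inf a g i
        - ∫ w in remainingEvent W X N a S, ‖Y w‖ ^ 2 ∂P
      = ∫ w, ‖Y w‖ ^ 2 ∂P - (∫ w in remainingEvent W X N a S, ‖Y w‖ ^ 2 ∂P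
        + ∑ i ∈ S, ∫ w in atomEvent W X a i, ‖g i (reducedVar U11inf X w)‖ ^ 2 ∂P)
        - 1 / lam * ∑ i ∈ S, ∫ w in atomEvent W X a i,
          inner ℝ (Y w - g i (reducedVar U11inf X w))
            ((lam : ℂ) * g i (reducedVar U11inf X w)) ∂P := by
    rw [Finset.sum_congr rfl fun i hi => lossReduction_eq hX hY hlam hkpos hkint (hg i hi),
      Finset.sum_add_distrib, Finset.mul_sum]
    ring
  rw [hlim]
  exact tendsto_const_nhds.sub h

end Dual

end

/-! ### The limit of the minimal losses -/

theorem mainTheorem5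
    {V : Type*} [NormedAddCommGroup V] [InnerProductSpace ℝ V] [FiniteDimensional ℝ V]
    [MeasurableSpace V] [BorelSpace V]
    {Ω : Type*} [MeasurableSpace Ω] (P : Measure Ω) [IsProbabilityMeasure P]
    (X : Ω → V) (hX : Measurable X) (Y : Ω → ℂ) (hY : MemLp Y 2 P)
    (lam : ℝ) (hlam : 0 < lam)
    -- the spectral density of the kernel
    (kV : V → ℝ) (hkpos : ∀ ξ, 0 < kV ξ) (hkint : Integrable kV) (hkone : ∫ ξ, kV ξ = 1)
    -- the decomposition `V = W ⊕ Wᗮ` and the sequence `U k` tending to infinity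
    (W : Submodule ℝ V) (U : ℕ → V →L[ℝ] V) (U11inf : W →L[ℝ] W)
    (hU11 : Tendsto (fun k => block W W (U k)) atTop (𝓝 U11inf))
    (hU21 : ∀ k, block Wᗮ W (U k) = 0)
    (Lam : ℕ → ℝ) (hLam : Tendsto Lam atTop atTop)
    (hU22 : ∀ k, ∀ x : Wᗮ, Lam k * ‖x‖ ≤ ‖block Wᗮ Wᗮ (U k) x‖)
    -- the atoms of the law of the component of `X` in `Wᗮ`, enumerated without repetition
    (N : ℕ∞) (a : ℕ → Wᗮ) (ha_inj : Set.InjOn a {i | (i : ℕ∞) < N})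
    (ha : a '' {i | (i : ℕ∞) < N} =
      {y | P {w | Wᗮ.orthogonalProjectionOnto (X w) = y} ≠ 0})
    -- the minimizers of the dimensionally reduced problems, one for each atom
    (g : ℕ → W → ℂ)
    (hg : ∀ i : ℕ, (i : ℕ∞) < N → IsRidgeMinimizer
      (P.restrict {w | Wᗮ.orthogonalProjectionOnto (X w) = a i})
      (fun w => U11inf (W.orthogonalProjectionOnto (X w))) Y (marginalDensity W kV) lam (g i))
    -- the minimizers of the full problems
    (fU : ℕ → V → ℂ)
    (hfU : ∀ k, IsRidgeMinimizer P (fun w => U k (X w)) Y kV lam (fU k)) :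
    (∀ m k, MemRKHS kV (testFunction W kV N a g (U k) m)) ∧
    ∃ L : ℕ → ℝ,
      (∀ m, Tendsto (fun k =>
          (∫ w, ‖(testFunction W kV N a g (U k) m - fU k) (U k (X w))‖ ^ 2 ∂P)
            + lam * rkhsNormSq kV (testFunction W kV N a g (U k) m - fU k))
          atTop (𝓝 (L m))) ∧
      (∀ m, L m ≤ ∫ w in {w | ∃ i : ℕ, m ≤ i ∧ (i : ℕ∞) < N ∧
          Wᗮ.orthogonalProjectionOnto (X w) = a i}, ‖Y w‖ ^ 2 ∂P) ∧
      Tendsto L atTop (𝓝 0) := by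

  classical
  have hκ := isSpectralDensity_of_pos hkpos hkint
  have hUX : ∀ k, Measurable fun w => U k (X w) := fun k => (U k).continuous.measurable.comp hX
  have hgm : ∀ i : ℕ, (i : ℕ∞) < N → MemRKHS (marginalDensity W kV) (g i) :=
    fun i hi => (hg i hi).1
  have hmem := fun m => (tendsto_rkhsNormSq_testFunction (a := a) hkpos hkint hLam hU21 hU22
    ha_inj hgm m).1
  refine ⟨hmem, ?_⟩
  -- the index sets, the loss reductions and the second moments on the atoms, extended by zero
  -- to all natural numbers
  set S : ℕ → Finset ℕ := fun m => (Finset.range m).filter (fun i : ℕ => (i : ℕ∞) < N)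
  have hSN : ∀ m, ∀ i ∈ S m, (i : ℕ∞) < N := fun m i hi => (Finset.mem_filter.1 hi).2
  set B : ℕ → Set Ω := fun i => if (i : ℕ∞) < N then atomEvent W X a i else ∅ with hB
  set c : ℕ → ℝ := fun i =>
    if (i : ℕ∞) < N then lossReduction P X Y kV lam U11inf a g i else 0 with hc
  have hBm : ∀ i, MeasurableSet (B i) := fun i => by
    simp only [hB]
    split_ifs
    exacts [measurableSet_atomEvent hX i, MeasurableSet.empty]
  have hBd : Pairwise (Function.onFun Disjoint B) := fun i j hij => by
    refine Set.disjoint_left.2 fun w hi hj => ?_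
    simp only [hB] at hi hj
    split_ifs at hi hj with h1 h2
    exacts [hij (atomEvent_unique ha_inj h1 h2 hi hj), hj, hi, hi]
  have hY2 : Integrable (fun w => ‖Y w‖ ^ 2) P := hY.integrable_norm_sq
  have hcB : ∀ i, c i ∈ Set.Icc 0 (∫ w in B i, ‖Y w‖ ^ 2 ∂P) := fun i => by
    simp only [hB, hc]
    split_ifs with h
    · exact lossReduction_mem_Icc hX hY hlam hkpos hkint (hg i h)
    · simp
  have htail : ∀ m, HasSum (fun i => ∫ w in B (i + m), ‖Y w‖ ^ 2 ∂P)
      (∫ w in remainingEvent W X N a (S m), ‖Y w‖ ^ 2 ∂P) := fun m => by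
    have hU : remainingEvent W X N a (S m) = ⋃ i, B (i + m) := by
      ext w
      simp only [Set.mem_iUnion, hB]
      constructor
      · rintro ⟨i, hi, hiN, hw⟩
        have him : m ≤ i := not_lt.1 fun h =>
          hi (Finset.mem_filter.2 ⟨Finset.mem_range.2 h, hiN⟩)
        refine ⟨i - m, ?_⟩
        rw [Nat.sub_add_cancel him, if_pos hiN]
        exact hw
      · rintro ⟨i, hw⟩
        split_ifs at hw with hiN
        · exact ⟨i + m, fun h => by
            have := Finset.mem_range.1 (Finset.mem_filter.1 h).1
            omega, hiN, hw⟩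
        · exact absurd hw (Set.notMem_empty w)
    rw [hU]
    exact hasSum_integral_iUnion (fun i => hBm (i + m))
      (fun i j hij => hBd fun h => hij (Nat.add_right_cancel h)) hY2.integrableOn
  have ht0 : Summable fun i => ∫ w in B i, ‖Y w‖ ^ 2 ∂P := (htail 0).summable
  have hcs : Summable c := ht0.of_nonneg_of_le (fun i => (hcB i).1) fun i => (hcB i).2
  have htail0 : Tendsto (fun m => ∫ w in remainingEvent W X N a (S m), ‖Y w‖ ^ 2 ∂P) atTop
      (𝓝 0) := by
    simp_rw [fun m => (htail m).tsum_eq.symm]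
    exact tendsto_sum_nat_add fun i => ∫ w in B i, ‖Y w‖ ^ 2 ∂P
  have hsum : ∀ m, ∑ i ∈ S m, lossReduction P X Y kV lam U11inf a g i
      = ∑ i ∈ Finset.range m, c i := fun m => Finset.sum_filter _ _
  have hprimal : ∀ m, Tendsto (fun k => 2 * ridgeLoss P (fun w => U k (X w)) Y kV lam
      (testFunction W kV N a g (U k) m)) atTop
      (𝓝 (∫ w, ‖Y w‖ ^ 2 ∂P - ∑ i ∈ Finset.range m, c i)) := fun m => by
    rw [← hsum]
    exact tendsto_ridgeLoss_testFunction hX hY hkpos hkint hU11 hLam hU21 hU22 ha_inj hgm m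
  -- the test functions bound the minimal losses from above, the dual certificates from below
  have hmin : Tendsto (fun k => 2 * ridgeLoss P (fun w => U k (X w)) Y kV lam (fU k)) atTop
      (𝓝 (∫ w, ‖Y w‖ ^ 2 ∂P - ∑' i, c i)) := by
    have hS := (tendsto_const_nhds (x := ∫ w, ‖Y w‖ ^ 2 ∂P)).sub hcs.hasSum.tendsto_sum_nat
    refine tendsto_order.2 ⟨fun b hb => ?_, fun b hb => ?_⟩
    · have hS' := hS.sub htail0
      rw [sub_zero] at hS'
      obtain ⟨m, hm⟩ := (hS'.eventually_const_lt hb).exists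
      obtain ⟨D, hD, hDle⟩ := exists_tendsto_le_ridgeLoss hX hY hlam hkpos hkint hU11 hLam hU21
        hU22 ha_inj ha (hSN m) fun i hi => hg i (hSN m i hi)
      rw [hsum] at hD
      filter_upwards [hD.eventually_const_lt hm] with k hk
      exact hk.trans_le (hDle k _ (hfU k).1)
    · obtain ⟨m, hm⟩ := (hS.eventually_lt_const hb).exists
      filter_upwards [(hprimal m).eventually_lt_const hm] with k hk
      refine lt_of_le_of_lt ?_ hk
      have := (hfU k).2 _ (hmem m k)
      linarith
  refine ⟨fun m => ∑' i, c (i + m), fun m => ?_, fun m => ?_, tendsto_sum_nat_add c⟩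
  · simp_rw [fun k => (hfU k).integral_sq_add_rkhsNormSq_sub hκ hlam (hUX k) hY (hmem m k)]
    have h := (hprimal m).sub hmin
    rw [← hcs.sum_add_tsum_nat_add m] at h
    convert h using 2
    ring
  · have hset : {w | ∃ i : ℕ, m ≤ i ∧ (i : ℕ∞) < N ∧ Wᗮ.orthogonalProjectionOnto (X w) = a i}
        = remainingEvent W X N a (S m) := by
      ext w
      refine exists_congr fun i => ⟨fun h => ⟨fun hi => ?_, h.2.1, h.2.2⟩, fun h =>
        ⟨not_lt.1 fun hi => h.1 (Finset.mem_filter.2 ⟨Finset.mem_range.2 hi, h.2.1⟩),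
          h.2.1, h.2.2⟩⟩
      exact absurd (Finset.mem_range.1 (Finset.mem_filter.1 hi).1) (not_lt.2 h.1)
    rw [hset, ← (htail m).tsum_eq]
    exact ((summable_nat_add_iff m).2 hcs).tsum_le_tsum (fun i => (hcB (i + m)).2)
      (htail m).summable
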